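/- Conventions. Everything is smooth. Let $M$ be a connected manifold (Hausdorff, second countable, without boundary) of dimension $2n+1$, $n\ge 0$. A contact form is a 1-form $\eta$ with $\eta\wedge(d\eta)^n\neq 0$ everywhere; it represents the co-oriented contact structure $\mathcal D=\ker\eta$, and another contact form $\eta'$ represents the same co-oriented contact structure iff $\eta'=g\eta$ with $g>0$. Its Reeb vector field $R_\eta$ is determined by $\eta(R_\eta)=1$, $d\eta(R_\eta,\cdot)=0$. An infinitesimal contact transformation is a vector field $X$ such that $[X,Y]$ is a section of $\mathcal D$ for every section $Y$ of $\mathcal D$; the Hamiltonian vector field $X_f$ of a function $f$ (with respect to $\eta$) is the unique infinitesimal contact transformation with $\eta(X_f)=f$. Let $\mathfrak{Con}(M,\mathcal D)^+$ be the group of diffeomorphisms $\phi$ of $M$ with $\phi^*\eta=f_\phi\,\eta$, $f_\phi>0$, and $\mathfrak{Con}(M,\eta)$ the group of those with $\phi^*\eta=\eta$. A completely integrable contact Hamiltonian system $(M,\mathcal D,\eta,f_0,\dots,f_n)$ consists of functions $f_0,\dots,f_n\in C^\infty(M)$ such that $X_{f_0}f_i=0$ for all $i$ (they are first integrals of the Hamiltonian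 $f_0$), $\{f_i,f_j\}_\eta:=\eta([X_{f_i},X_{f_j}])=0$ for all $i,j$, and $X_{f_0},\dots,X_{f_n}$ are pointwise linearly independent on a dense open subset of $M$. It is completely good (with respect to $\eta$) if $R_\eta f_i=0$ for all $i$. Proposition 3.6. Let $(M^{2n+1},\mathcal D,\eta,f_0,f_1,\dots,f_n)$ be a completely integrable contact Hamiltonian system with Hamiltonian vector fields $X_i=X_{f_i}$. Suppose that $\mathcal A\subset\mathfrak{Con}(M,\mathcal D)^+$ is an abelian subgroup which is an $(n+1)$-dimensional Lie group acting smoothly and properly on $M$, and that its Lie algebra, viewed as the space of its fundamental vector fields on $M$, is the span of $X_0,\dots,X_n$. Then there is a contact form $\eta_0$ representing the co-oriented contact structure $\mathcal D$ such that $\mathcal A\subset\mathfrak{Con}(M,\eta_0)$ and the corresponding system $(M,\mathcal D,\eta_0,\eta_0(X_0),\dots,\eta_0(X_n))$, whose Hamiltonian vector fields with respect to $\eta_0$ are the same $X_0,\dots,X_n$, is a completely integrable contact Hamiltonian system which is completely good with respect to $\eta_0$. -/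

import Mathlib

open scoped Manifold ContDiff Topology
open Bundle

noncomputable section

namespace ContactGeometry

section DiffeomorphismGroup

variable {d : ℕ} {M : Type*} [TopologicalSpace M] [ChartedSpace (EuclideanSpace ℝ (Fin d)) M]

/-- The diffeomorphisms of `M` form a group under composition, `(φ * ψ) x = φ (ψ x)`. -/
instance diffeoGroup : Group (M ≃ₘ⟮𝓡 d, 𝓡 d⟯ M) where
  mul φ ψ := ψ.trans φ
  one := Diffeomorph.refl (𝓡 d) M ∞
  inv φ := φ.symm
  mul_assoc _ _ _ := Diffeomorph.ext fun _ => rfl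
  one_mul _ := Diffeomorph.ext fun _ => rfl
  mul_one _ := Diffeomorph.ext fun _ => rfl
  inv_mul_cancel φ := φ.self_trans_symm

/-- The tautological action of the diffeomorphism group on `M`. -/
instance diffeoMulAction : MulAction (M ≃ₘ⟮𝓡 d, 𝓡 d⟯ M) M where
  smul φ x := φ x
  one_smul _ := rfl
  mul_smul _ _ _ := rfl

end DiffeomorphismGroup

section Forms

variable (d : ℕ) (M : Type*) [TopologicalSpace M] [ChartedSpace (EuclideanSpace ℝ (Fin d)) M]

/-- Not necessarily smooth vector fields on a `d`-dimensional manifold. -/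
abbrev VField : Type _ := (x : M) → TangentSpace (𝓡 d) x

/-- Not necessarily smooth differential 1-forms on a `d`-dimensional manifold. -/
abbrev OneForm : Type _ := (x : M) → (TangentSpace (𝓡 d) x →L[ℝ] ℝ)

variable {d M}

/-- Smooth vector fields: smooth sections of the tangent bundle. -/
def SmoothField [IsManifold (𝓡 d) ∞ M] (X : VField d M) : Prop :=
  ContMDiff (𝓡 d) (𝓡 d).tangent ∞
    (fun x => (TotalSpace.mk' (EuclideanSpace ℝ (Fin d)) x (X x) : TangentBundle (𝓡 d) M))

/-- Smooth 1-forms: smooth sections of the cotangent bundle. -/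
def SmoothForm [IsManifold (𝓡 d) ∞ M] (η : OneForm d M) : Prop :=
  ContMDiff (𝓡 d) ((𝓡 d).prod 𝓘(ℝ, EuclideanSpace ℝ (Fin d) →L[ℝ] ℝ)) ∞
    (fun x => TotalSpace.mk' (EuclideanSpace ℝ (Fin d) →L[ℝ] ℝ)
      (E := fun x : M => TangentSpace (𝓡 d) x →L[ℝ] Bundle.Trivial M ℝ x) x (η x))

/-- The expression of a 1-form in the preferred chart at `x₀`: its pullback under the inverse of
that chart. -/
def chartForm (η : OneForm d M) (x₀ : M) (y : EuclideanSpace ℝ (Fin d)) :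
    EuclideanSpace ℝ (Fin d) →L[ℝ] ℝ :=
  (η ((extChartAt (𝓡 d) x₀).symm y)).comp
    (mfderiv 𝓘(ℝ, EuclideanSpace ℝ (Fin d)) (𝓡 d) (extChartAt (𝓡 d) x₀).symm y)

/-- The exterior derivative `dη` of a 1-form, computed at `x` in the preferred chart at `x`.
The normalization is `dη(X, Y) = X η(Y) - Y η(X) - η([X, Y])`. -/
def extDerivForm (η : OneForm d M) (x : M) : TangentSpace (𝓡 d) x [⋀^Fin 2]→L[ℝ] ℝ :=
  (extDeriv (fun y => ContinuousAlternatingMap.ofSubsingleton ℝ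
      (EuclideanSpace ℝ (Fin d)) ℝ (0 : Fin 1) (chartForm η x y))
    (extChartAt (𝓡 d) x x)).compContinuousLinearMap
      (mfderiv (𝓡 d) 𝓘(ℝ, EuclideanSpace ℝ (Fin d)) (extChartAt (𝓡 d) x) x)

/-- The derivative `X f = df(X)` of a function along a vector field. -/
def fieldDeriv (X : VField d M) (f : M → ℝ) (x : M) : ℝ :=
  mfderiv (𝓡 d) 𝓘(ℝ, ℝ) f x (X x)

end Forms

/-- The value of `α ∧ β ∧ ⋯ ∧ β` (with `n` factors `β`) on `2n + 1` vectors, for a linear form `α`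
and an alternating 2-form `β`. -/
def wedgePow {V : Type*} [AddCommGroup V] [Module ℝ V] [TopologicalSpace V] (n : ℕ)
    (α : V →L[ℝ] ℝ) (β : V [⋀^Fin 2]→L[ℝ] ℝ) (v : Fin (2 * n + 1) → V) : ℝ :=
  (1 / 2 ^ n : ℝ) * ∑ σ : Equiv.Perm (Fin (2 * n + 1)), ((Equiv.Perm.sign σ : ℤ) : ℝ) *
    (α (v (σ 0)) * ∏ i : Fin n,
      β ![v (σ ⟨2 * i.val + 1, by omega⟩), v (σ ⟨2 * i.val + 2, by omega⟩)])

section Contact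

variable {n : ℕ} {M : Type*} [TopologicalSpace M]
  [ChartedSpace (EuclideanSpace ℝ (Fin (2 * n + 1))) M] [IsManifold (𝓡 (2 * n + 1)) ∞ M]

/-- Contact forms on a `(2n+1)`-manifold: smooth 1-forms with `η ∧ (dη)ⁿ ≠ 0` everywhere. The
contact structure represented by `η` is `D = ker η`, co-oriented by `η`. -/
structure IsContactForm (η : OneForm (2 * n + 1) M) : Prop where
  smooth : SmoothForm η
  nondegenerate : ∀ x, ∃ v : Fin (2 * n + 1) → TangentSpace (𝓡 (2 * n + 1)) x,
    wedgePow n (η x) (extDerivForm η x) v ≠ 0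

/-- `η'` represents the same co-oriented contact structure as `η`: `η' = g η` with `g` smooth and
everywhere positive. -/
def SameContactStructure (η η' : OneForm (2 * n + 1) M) : Prop :=
  ∃ g : M → ℝ, ContMDiff (𝓡 (2 * n + 1)) 𝓘(ℝ, ℝ) ∞ g ∧ (∀ x, 0 < g x) ∧
    ∀ x, η' x = g x • η x

/-- The group `Con(M, D)⁺`, `D = ker η`, of diffeomorphisms `φ` that preserve `D` together with its
co-orientation: `φ^* η = f η` with `f > 0` everywhere. -/
def contactomorphismsPos (η : OneForm (2 * n + 1) M) :
    Set (M ≃ₘ⟮𝓡 (2 * n + 1), 𝓡 (2 * n + 1)⟯ M) :=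
  {φ | ∃ f : M → ℝ, (∀ x, 0 < f x) ∧ ∀ x (v : TangentSpace (𝓡 (2 * n + 1)) x),
    η (φ x) (mfderiv (𝓡 (2 * n + 1)) (𝓡 (2 * n + 1)) φ x v) = f x * η x v}

/-- The group `Con(M, η)` of strict contactomorphisms: `φ^* η = η`. -/
def strictContactomorphisms (η : OneForm (2 * n + 1) M) :
    Set (M ≃ₘ⟮𝓡 (2 * n + 1), 𝓡 (2 * n + 1)⟯ M) :=
  {φ | ∀ x (v : TangentSpace (𝓡 (2 * n + 1)) x),
    η (φ x) (mfderiv (𝓡 (2 * n + 1)) (𝓡 (2 * n + 1)) φ x v) = η x v}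

/-- The Lie algebra of infinitesimal contact transformations of `D = ker η`: smooth vector fields
`X` such that `[X, Y]` is a section of `D` for every smooth section `Y` of `D`. -/
structure IsContactField (η : OneForm (2 * n + 1) M) (X : VField (2 * n + 1) M) : Prop where
  smooth : SmoothField X
  bracket : ∀ Y : VField (2 * n + 1) M, SmoothField Y → (∀ x, η x (Y x) = 0) →
    ∀ x, η x (VectorField.mlieBracket (𝓡 (2 * n + 1)) X Y x) = 0

/-- `X` is the Hamiltonian vector field of `h` with respect to the contact form `η`: the (unique)
infinitesimal contact transformation with `η(X) = h`. -/
structure IsHamiltonianField (η : OneForm (2 * n + 1) M) (h : M → ℝ)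
    (X : VField (2 * n + 1) M) : Prop where
  contact : IsContactField η X
  contraction : ∀ x, η x (X x) = h x

/-- `R` is the Reeb vector field of `η`: `η(R) = 1` and `dη(R, ·) = 0`. For a contact form these
equations determine `R` at each point, and `R` is then smooth. -/
structure IsReebField (η : OneForm (2 * n + 1) M) (R : VField (2 * n + 1) M) : Prop where
  normalized : ∀ x, η x (R x) = 1
  kernel : ∀ x (v : TangentSpace (𝓡 (2 * n + 1)) x), extDerivForm η x ![R x, v] = 0

/-- The function `h` is good with respect to `η`: it is constant along the Reeb flow,
`R_η h = 0`. -/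
def IsGoodHamiltonian (η : OneForm (2 * n + 1) M) (h : M → ℝ) : Prop :=
  ∃ R : VField (2 * n + 1) M, IsReebField η R ∧ ∀ x, fieldDeriv R h x = 0

/-- `(M, D = ker η, η, f₀, …, fₙ)` is a completely integrable contact Hamiltonian system with
Hamiltonian `h = f₀`, where `X i` is the Hamiltonian vector field of `f i`. -/
structure IsCompletelyIntegrable (η : OneForm (2 * n + 1) M)
    (f : Fin (n + 1) → M → ℝ) (X : Fin (n + 1) → VField (2 * n + 1) M) : Prop where
  contactForm : IsContactForm η
  smooth : ∀ i, ContMDiff (𝓡 (2 * n + 1)) 𝓘(ℝ, ℝ) ∞ (f i)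
  hamiltonian : ∀ i, IsHamiltonianField η (f i) (X i)
  /-- `f₀, …, fₙ` are first integrals of the Hamiltonian `f₀`. -/
  firstIntegral : ∀ i x, fieldDeriv (X 0) (f i) x = 0
  /-- The Jacobi brackets `{f i, f j}_η = η([X i, X j])` vanish. -/
  involution : ∀ i j x, η x (VectorField.mlieBracket (𝓡 (2 * n + 1)) (X i) (X j) x) = 0
  /-- The Hamiltonian vector fields are pointwise independent on a dense open set. -/
  independent : ∃ U : Set M, IsOpen U ∧ Dense U ∧ ∀ x ∈ U, LinearIndependent ℝ fun i => X i x

/-- A completely integrable contact Hamiltonian system is completely good if each of its first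
integrals is good with respect to `η` (for `f₀` this is automatic). -/
structure IsCompletelyGood (η : OneForm (2 * n + 1) M)
    (f : Fin (n + 1) → M → ℝ) (X : Fin (n + 1) → VField (2 * n + 1) M) : Prop where
  completelyIntegrable : IsCompletelyIntegrable η f X
  good : ∀ i, IsGoodHamiltonian η (f i)

end Contact

/-- The fundamental vector field on `M` of an element `ξ` of the Lie algebra `T₁G` of a Lie group
`G` acting smoothly on `M`: its value at `x` is the derivative of `a ↦ a • x` at `1`, applied
to `ξ`. -/
def fundamentalField {k d : ℕ} {M G : Type*} [TopologicalSpace M]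
    [ChartedSpace (EuclideanSpace ℝ (Fin d)) M] [Group G] [TopologicalSpace G]
    [ChartedSpace (EuclideanSpace ℝ (Fin k)) G] [MulAction G M]
    (ξ : TangentSpace (𝓡 k) (1 : G)) : VField d M :=
  fun x => (mfderiv (𝓡 k) (𝓡 d) (fun a : G => a • x) 1 ξ : EuclideanSpace ℝ (Fin d))

end ContactGeometry

end

open ContactGeometry

/-! The contact form is averaged over `A`. Write `a^*η = c_a η` with `c_a > 0`. Since `A` need not
be compact, one averages not `η` but `χη`, where `χ ≥ 0` is smooth, nonzero somewhere on every
orbit, and such that, for `x` in a small open set, `χ(a • x)` vanishes for `a` outside a fixed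
compact set. Such a `χ` exists because the action is proper (`exists_cutoff_of_properSMul`). The
Haar integral of `a^*(χη)` is `η₀ = gη` with `g(x) = ∫ χ(a • x) c_a(x) da`; this `g` is smooth and
positive, and the cocycle rule for `c` together with commutativity of `A` makes `gη` invariant
(`exists_invariant_rescaling`).

On `ker η` one has `d(gη) = g dη`, so `η₀ ∧ (dη₀)ⁿ = gⁿ⁺¹ η ∧ (dη)ⁿ` and `η₀` is again a contact
form (`IsContactForm.smul`). The contact fields, the vanishing of the brackets `η([X_i, X_j])` and
the independence of the `X_i` depend only on `ker η` and the fields, so they survive the rescaling.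

Each `X_i` is a fundamental field. As `A` is abelian, `X_i` is `A`-invariant, hence so is `η₀(X_i)`,
and it is constant along `X_0`. Invariance of `η₀` also gives Cartan's formula `d(η₀(X_i)) =
-dη₀(X_i, ·)` (`mfderiv_contraction_of_invariant`); at the Reeb field the right-hand side vanishes,
which is goodness. -/

noncomputable section

namespace ContactGeometry

/-! ### Linear algebra of `α ∧ βⁿ` in odd dimension -/

section WedgePower

variable {V : Type*} [AddCommGroup V] [Module ℝ V] [TopologicalSpace V]

theorem update_pair_zero {W : Type*} (a b x : W) : Function.update ![a, b] 0 x = ![x, b] := by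
  ext i; fin_cases i <;> simp

theorem update_pair_one {W : Type*} (a b x : W) : Function.update ![a, b] 1 x = ![a, x] := by
  ext i; fin_cases i <;> simp

/-- The bilinear form underlying an alternating 2-form. -/
def bilinOfForm (β : V [⋀^Fin 2]→L[ℝ] ℝ) : V →ₗ[ℝ] V →ₗ[ℝ] ℝ :=
  LinearMap.mk₂ ℝ (fun u v => β ![u, v])
    (fun a b v => by simpa only [update_pair_zero] using β.map_update_add ![a, v] 0 a b)
    (fun c a v => by simpa only [update_pair_zero] using β.map_update_smul ![a, v] 0 c a)
    (fun u a b => by simpa only [update_pair_one] using β.map_update_add ![u, a] 1 a b)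
    (fun c u a => by simpa only [update_pair_one] using β.map_update_smul ![u, a] 1 c a)

@[simp]
theorem bilinOfForm_apply (β : V [⋀^Fin 2]→L[ℝ] ℝ) (u v : V) :
    bilinOfForm β u v = β ![u, v] := rfl

theorem form_swap (β : V [⋀^Fin 2]→L[ℝ] ℝ) (u v : V) : β ![u, v] = -β ![v, u] := by
  have h := β.toAlternatingMap.map_swap ![v, u] (i := 0) (j := 1) (by decide)
  have e : ![v, u] ∘ ⇑(Equiv.swap (0 : Fin 2) 1) = ![u, v] := by
    ext i; fin_cases i <;> simp
  rw [e] at h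
  exact h

theorem fin_odd_cases {n : ℕ} (i : Fin (2 * n + 1)) :
    i = 0 ∨ (∃ j : Fin n, i = ⟨2 * j.val + 1, by omega⟩) ∨
      ∃ j : Fin n, i = ⟨2 * j.val + 2, by omega⟩ := by
  obtain ⟨i, hi⟩ := i
  rcases Nat.eq_zero_or_pos i with h | h
  · exact Or.inl (Fin.ext (by simpa using h))
  · rcases Nat.even_or_odd' i with ⟨c, hc | hc⟩
    · exact Or.inr (Or.inr ⟨⟨c - 1, by omega⟩, Fin.ext (by simp; omega)⟩)
    · exact Or.inr (Or.inl ⟨⟨c, by omega⟩, Fin.ext (by simp; omega)⟩)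

/-- The product `α ⊗ β ⊗ ⋯ ⊗ β` evaluated on `2n + 1` vectors. -/
def tensorVal (n : ℕ) (α : V →L[ℝ] ℝ) (β : V [⋀^Fin 2]→L[ℝ] ℝ) (v : Fin (2 * n + 1) → V) : ℝ :=
  α (v 0) * ∏ i : Fin n, β ![v ⟨2 * i.val + 1, by omega⟩, v ⟨2 * i.val + 2, by omega⟩]

/-- Both multilinearity axioms follow at once from linearity in a single slot. The three cases are
the slot of `α` and the first or second slot of a factor `β`. The decidability instance is arbitrary
because the fields of `MultilinearMap` quantify over it. -/
theorem tensorVal_update (n : ℕ) (α : V →L[ℝ] ℝ) (β : V [⋀^Fin 2]→L[ℝ] ℝ)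
    [DecidableEq (Fin (2 * n + 1))] (v : Fin (2 * n + 1) → V) (i : Fin (2 * n + 1)) :
    ∃ l : V →ₗ[ℝ] ℝ, ∀ x, tensorVal n α β (Function.update v i x) = l x := by
  rcases fin_odd_cases i with rfl | ⟨j, rfl⟩ | ⟨j, rfl⟩
  · refine ⟨(∏ i : Fin n, β ![v ⟨2 * i.val + 1, by omega⟩, v ⟨2 * i.val + 2, by omega⟩]) •
      (α : V →ₗ[ℝ] ℝ), fun x => ?_⟩
    simp only [tensorVal, Function.update_self, LinearMap.smul_apply, smul_eq_mul,
      ContinuousLinearMap.coe_coe]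
    rw [mul_comm]
    congr 1
    refine Finset.prod_congr rfl fun k _ => ?_
    rw [Function.update_of_ne (by simp [Fin.ext_iff]), Function.update_of_ne (by simp [Fin.ext_iff])]
  · refine ⟨(α (v 0) * ∏ i ∈ Finset.univ.erase j,
      β ![v ⟨2 * i.val + 1, by omega⟩, v ⟨2 * i.val + 2, by omega⟩]) •
      (bilinOfForm β).flip (v ⟨2 * j.val + 2, by omega⟩), fun x => ?_⟩
    simp only [tensorVal, LinearMap.smul_apply, smul_eq_mul, LinearMap.flip_apply,
      bilinOfForm_apply]
    rw [← Finset.prod_erase_mul _ _ (Finset.mem_univ j), ← mul_assoc,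
      Function.update_of_ne (by simp [Fin.ext_iff])]
    congr 1
    · congr 1
      refine Finset.prod_congr rfl fun k hk => ?_
      have : k.val ≠ j.val := fun h => Finset.ne_of_mem_erase hk (Fin.ext h)
      rw [Function.update_of_ne (by simp [Fin.ext_iff]; omega),
        Function.update_of_ne (by simp [Fin.ext_iff]; omega)]
    · rw [Function.update_self, Function.update_of_ne (by simp [Fin.ext_iff])]
  · refine ⟨(α (v 0) * ∏ i ∈ Finset.univ.erase j,
      β ![v ⟨2 * i.val + 1, by omega⟩, v ⟨2 * i.val + 2, by omega⟩]) •
      (bilinOfForm β) (v ⟨2 * j.val + 1, by omega⟩), fun x => ?_⟩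
    simp only [tensorVal, LinearMap.smul_apply, smul_eq_mul, bilinOfForm_apply]
    rw [← Finset.prod_erase_mul _ _ (Finset.mem_univ j), ← mul_assoc,
      Function.update_of_ne (by simp [Fin.ext_iff])]
    congr 1
    · congr 1
      refine Finset.prod_congr rfl fun k hk => ?_
      have : k.val ≠ j.val := fun h => Finset.ne_of_mem_erase hk (Fin.ext h)
      rw [Function.update_of_ne (by simp [Fin.ext_iff]; omega),
        Function.update_of_ne (by simp [Fin.ext_iff]; omega)]
    · rw [Function.update_self, Function.update_of_ne (by simp [Fin.ext_iff])]

/-- `tensorVal` as a multilinear map. -/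
def tensorMultilinear (n : ℕ) (α : V →L[ℝ] ℝ) (β : V [⋀^Fin 2]→L[ℝ] ℝ) :
    MultilinearMap ℝ (fun _ : Fin (2 * n + 1) => V) ℝ where
  toFun := tensorVal n α β
  map_update_add' v i x y := by
    obtain ⟨l, hl⟩ := tensorVal_update n α β v i
    simp [hl]
  map_update_smul' v i c x := by
    obtain ⟨l, hl⟩ := tensorVal_update n α β v i
    simp [hl]

/-- `α ∧ βⁿ` as an alternating map, up to the factor `1 / 2ⁿ`. -/
def wedgeAlternating (n : ℕ) (α : V →L[ℝ] ℝ) (β : V [⋀^Fin 2]→L[ℝ] ℝ) :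
    V [⋀^Fin (2 * n + 1)]→ₗ[ℝ] ℝ :=
  MultilinearMap.alternatization (tensorMultilinear n α β)

theorem wedgeAlternating_apply (n : ℕ) (α : V →L[ℝ] ℝ) (β : V [⋀^Fin 2]→L[ℝ] ℝ)
    (v : Fin (2 * n + 1) → V) : wedgeAlternating n α β v =
      ∑ σ : Equiv.Perm (Fin (2 * n + 1)), ((Equiv.Perm.sign σ : ℤ) : ℝ) *
        tensorVal n α β (fun i => v (σ i)) := by
  rw [wedgeAlternating, MultilinearMap.alternatization_apply]
  refine Finset.sum_congr rfl fun σ _ => ?_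
  rw [Units.smul_def, zsmul_eq_mul]
  rfl

theorem wedgePow_eq (n : ℕ) (α : V →L[ℝ] ℝ) (β : V [⋀^Fin 2]→L[ℝ] ℝ)
    (v : Fin (2 * n + 1) → V) :
    wedgePow n α β v = (1 / 2 ^ n : ℝ) * wedgeAlternating n α β v := by
  rw [wedgeAlternating_apply]
  rfl

theorem wedgePow_ne_zero_iff (n : ℕ) (α : V →L[ℝ] ℝ) (β : V [⋀^Fin 2]→L[ℝ] ℝ) :
    (∃ v, wedgePow n α β v ≠ 0) ↔ wedgeAlternating n α β ≠ 0 := by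
  simp only [wedgePow_eq, ne_eq, mul_eq_zero, not_or]
  constructor
  · rintro ⟨v, -, hv⟩ h
    exact hv (by rw [h]; rfl)
  · intro h
    by_contra! hv
    exact h (AlternatingMap.ext fun v => hv v (by positivity))

/-- If `α` and `β` have a common kernel vector, then `α ∧ βⁿ = 0` in dimension `2n + 1`. -/
theorem wedgeAlternating_eq_zero_of_mem_ker {n : ℕ} (hV : Module.finrank ℝ V = 2 * n + 1)
    (α : V →L[ℝ] ℝ) (β : V [⋀^Fin 2]→L[ℝ] ℝ) (R : V) (hR : R ≠ 0) (hα : α R = 0)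
    (hβ : ∀ w, β ![R, w] = 0) : wedgeAlternating n α β = 0 := by
  have : Module.Finite ℝ V := Module.finite_of_finrank_pos (by omega)
  have hβ' : ∀ w, β ![w, R] = 0 := fun w => by rw [form_swap, hβ, neg_zero]
  have hli : LinearIndepOn ℝ id ({R} : Set V) := LinearIndepOn.singleton hR
  -- Only injective families of vectors from a basis through `R` need testing. Such a family has `2n
  -- + 1` members, so it contains `R`, and every term of the sum then has a factor with `R` in one
  -- of its slots.
  let b := Module.Basis.extend hli
  have : Fintype (hli.extend (Set.subset_univ _)) := FiniteDimensional.fintypeBasisIndex b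
  have hcard : Fintype.card (hli.extend (Set.subset_univ _)) = 2 * n + 1 := by
    rw [← hV, Module.finrank_eq_card_basis b]
  refine Module.Basis.ext_alternating b fun v hv => ?_
  have hsurj : Function.Surjective v :=
    ((Fintype.bijective_iff_injective_and_card v).2 ⟨hv, by simp [hcard]⟩).2
  obtain ⟨i, hi⟩ := hsurj ⟨R, hli.subset_extend _ rfl⟩
  rw [wedgeAlternating_apply, AlternatingMap.zero_apply]
  refine Finset.sum_eq_zero fun σ _ => ?_
  have key : b (v (σ (σ.symm i))) = R := by
    rw [Equiv.apply_symm_apply, hi]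
    exact Module.Basis.extend_apply_self hli _
  rw [mul_eq_zero, tensorVal, mul_eq_zero, Finset.prod_eq_zero_iff]
  right
  rcases fin_odd_cases (σ.symm i) with h | ⟨j, h⟩ | ⟨j, h⟩ <;> rw [h] at key
  · left; rw [key, hα]
  · right; exact ⟨j, Finset.mem_univ _, by rw [key, hβ]⟩
  · right; exact ⟨j, Finset.mem_univ _, by rw [key, hβ']⟩

/-- `α ∧ βⁿ` depends on `β` only through its restriction to `ker α`. -/
theorem wedgeAlternating_smul_of_eqOn_ker {n : ℕ} [Module.Finite ℝ V] (α : V →L[ℝ] ℝ)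
    (β β' : V [⋀^Fin 2]→L[ℝ] ℝ) (g : ℝ)
    (h : ∀ u w, α u = 0 → α w = 0 → β' ![u, w] = g * β ![u, w]) :
    wedgeAlternating n (g • α) β' = (g * g ^ n) • wedgeAlternating n α β := by
  by_cases hα : α = 0
  · ext v
    simp [wedgeAlternating_apply, tensorVal, hα]
  obtain ⟨R, hR⟩ : ∃ R, α R = 1 := by
    obtain ⟨x, hx⟩ : ∃ x, α x ≠ 0 := by
      by_contra! hc
      exact hα (ContinuousLinearMap.ext hc)
    exact ⟨(α x)⁻¹ • x, by simp [hx]⟩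
  -- In a basis made of `R` and vectors of `ker α`, a term survives only if `α` receives `R`; by
  -- injectivity the factors `β` then receive vectors of `ker α` only, and each contributes one `g`.
  let b₀ := Module.finBasis ℝ (LinearMap.ker (α : V →ₗ[ℝ] ℝ))
  let b := Module.Basis.mkFinCons R b₀
    (fun c x hx hc => by
      have := congrArg α hc
      rw [LinearMap.mem_ker, ContinuousLinearMap.coe_coe] at hx
      simpa [hR, hx] using this)
    (fun z => ⟨-α z, by simp [hR]⟩)
  have hb0 : b 0 = R := by simp [b]
  have hbs : ∀ i, i ≠ 0 → α (b i) = 0 := fun i hi => by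
    obtain ⟨j, rfl⟩ := Fin.exists_succ_eq.2 hi
    simp [b]
  refine Module.Basis.ext_alternating b fun v hv => ?_
  rw [AlternatingMap.smul_apply, wedgeAlternating_apply, wedgeAlternating_apply, smul_eq_mul,
    Finset.mul_sum]
  refine Finset.sum_congr rfl fun σ _ => ?_
  rw [mul_left_comm]
  congr 1
  simp only [tensorVal]
  by_cases h0 : v (σ 0) = 0
  · have hker : ∀ i, i ≠ 0 → α (b (v (σ i))) = 0 := fun i hi => hbs _ fun hc =>
      hi (σ.injective (hv (hc.trans h0.symm)))
    have : ∀ j : Fin n, β' ![b (v (σ ⟨2 * j.val + 1, by omega⟩)),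
        b (v (σ ⟨2 * j.val + 2, by omega⟩))] = g * β ![b (v (σ ⟨2 * j.val + 1, by omega⟩)),
        b (v (σ ⟨2 * j.val + 2, by omega⟩))] := fun j =>
      h _ _ (hker _ (by simp [Fin.ext_iff])) (hker _ (by simp [Fin.ext_iff]))
    simp only [this, Finset.prod_mul_distrib, Finset.prod_const,
      Finset.card_univ, Fintype.card_fin, smul_apply, smul_eq_mul]
    ring
  · simp [hbs _ h0]

/-- A skew-symmetric matrix `J` of odd size is singular: `det J = det Jᵀ = det (-J) = -det J`. -/
theorem exists_ker_of_odd {n : ℕ} (hV : Module.finrank ℝ V = 2 * n + 1)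
    (β : V [⋀^Fin 2]→L[ℝ] ℝ) : ∃ R : V, R ≠ 0 ∧ ∀ w, β ![R, w] = 0 := by
  have : Module.Finite ℝ V := Module.finite_of_finrank_pos (by omega)
  let b := Module.finBasisOfFinrankEq ℝ V hV
  let J : Matrix (Fin (2 * n + 1)) (Fin (2 * n + 1)) ℝ := Matrix.of fun i j => β ![b i, b j]
  have hT : J.transpose = -J := by
    ext i j
    simpa [J] using form_swap β (b j) (b i)
  have hdet : J.det = 0 := by
    have h := congrArg Matrix.det hT
    rw [Matrix.det_transpose, Matrix.det_neg, Fintype.card_fin, Odd.neg_one_pow ⟨n, rfl⟩] at h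
    linarith
  obtain ⟨c, hc, hJ⟩ := Matrix.exists_mulVec_eq_zero_iff.2 hdet
  refine ⟨∑ j, c j • b j, fun h0 => hc ?_, fun w => ?_⟩
  · funext j
    exact Fintype.linearIndependent_iff.1 b.linearIndependent c h0 j
  · have : bilinOfForm β (∑ j, c j • b j) = 0 := by
      refine b.ext fun i => ?_
      have := congrFun hJ i
      simp only [Matrix.mulVec, dotProduct, J, Matrix.of_apply, Pi.zero_apply] at this
      simp only [map_sum, map_smul, LinearMap.sum_apply, LinearMap.smul_apply, bilinOfForm_apply,
        LinearMap.zero_apply, smul_eq_mul]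
      rw [← neg_eq_zero, ← this, ← Finset.sum_neg_distrib]
      refine Finset.sum_congr rfl fun j _ => ?_
      rw [form_swap β (b i) (b j)]
      ring
    rw [← bilinOfForm_apply, this, LinearMap.zero_apply]

/-- Existence of the Reeb vector at a point. -/
theorem exists_reeb_vector {n : ℕ} (hV : Module.finrank ℝ V = 2 * n + 1) (α : V →L[ℝ] ℝ)
    (β : V [⋀^Fin 2]→L[ℝ] ℝ) (h : ∃ v, wedgePow n α β v ≠ 0) :
    ∃ R : V, α R = 1 ∧ ∀ w, β ![R, w] = 0 := by
  rw [wedgePow_ne_zero_iff] at h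
  obtain ⟨R, hR, hβ⟩ := exists_ker_of_odd hV β
  have hα : α R ≠ 0 := fun hα => h (wedgeAlternating_eq_zero_of_mem_ker hV α β R hR hα hβ)
  refine ⟨(α R)⁻¹ • R, by simp [hα], fun w => ?_⟩
  rw [← bilinOfForm_apply, map_smul, LinearMap.smul_apply, bilinOfForm_apply, hβ, smul_zero]

end WedgePower

/-! ### Smoothness of derivatives and pairings -/

section SmoothPairings

variable {E H E' H' E'' H'' : Type*} [NormedAddCommGroup E] [NormedSpace ℝ E] [TopologicalSpace H]
  {I : ModelWithCorners ℝ E H} [NormedAddCommGroup E'] [NormedSpace ℝ E'] [TopologicalSpace H']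
  {I' : ModelWithCorners ℝ E' H'} [NormedAddCommGroup E''] [NormedSpace ℝ E'']
  [TopologicalSpace H''] {I'' : ModelWithCorners ℝ E'' H''}
  {N M P : Type*} [TopologicalSpace N] [ChartedSpace H N] [TopologicalSpace M] [ChartedSpace H' M]
  [IsManifold I' ∞ M] [TopologicalSpace P] [ChartedSpace H'' P] [IsManifold I'' ∞ P]

/-- The partial derivatives of a smooth family of maps, applied to a smooth family of vectors, are
smooth. -/
theorem contMDiffAt_mfderiv_vector {x₀ : N} [IsManifold I ∞ N] (f : N → M → P) (g : N → M)
    (Z : (x : N) → TangentSpace I' (g x))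
    (hf : ContMDiffAt (I.prod I') I'' ∞ (Function.uncurry f) (x₀, g x₀))
    (hZ : ContMDiffAt I I'.tangent ∞
      (fun x => (TotalSpace.mk' E' (g x) (Z x) : TangentBundle I' M)) x₀) :
    ContMDiffAt I I''.tangent ∞ (fun x => (TotalSpace.mk' E'' (f x (g x))
      (mfderiv I' I'' (f x) (g x) (Z x)) : TangentBundle I'' P)) x₀ := by
  have : IsManifold I' 1 M := .of_le (n := ∞) (by simp)
  have : IsManifold I'' 1 P := .of_le (n := ∞) (by simp)
  have : IsManifold I 1 N := .of_le (n := ∞) (by simp)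
  have hg : ContMDiffAt I I' ∞ g x₀ := by
    rw [contMDiffAt_totalSpace] at hZ
    exact hZ.1
  let b₂ : N → P := fun x => f x (g x)
  have hb₂ : ContMDiffAt I I'' ∞ b₂ x₀ :=
    ContMDiffAt.comp (g := Function.uncurry f) (f := fun x => (x, g x)) x₀ hf
      (contMDiffAt_id.prodMk hg)
  let ϕ : (x : N) → TangentSpace I' (g x) →L[ℝ] TangentSpace I'' (b₂ x) :=
    fun x => mfderiv I' I'' (f x) (g x)
  have hϕ : ContMDiffAt I 𝓘(ℝ, E' →L[ℝ] E'') ∞ (fun x => ContinuousLinearMap.inCoordinates E'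
      (TangentSpace I' (M := M)) E'' (TangentSpace I'' (M := P)) (g x₀) (g x) (b₂ x₀) (b₂ x)
      (ϕ x)) x₀ :=
    ContMDiffAt.mfderiv (m := ∞) f g hf hg (by simp)
  exact ContMDiffAt.clm_apply_of_inCoordinates hϕ hZ hb₂

variable {d : ℕ} {Q : Type*} [TopologicalSpace Q] [ChartedSpace (EuclideanSpace ℝ (Fin d)) Q]
  [IsManifold (𝓡 d) ∞ Q]

/-- The pairing of a smooth 1-form with a smooth family of tangent vectors is smooth. -/
theorem SmoothForm.contMDiffAt_apply {η : OneForm d Q} (hη : SmoothForm η) {x₀ : N} (b : N → Q)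
    (v : (x : N) → TangentSpace (𝓡 d) (b x))
    (hv : ContMDiffAt I (𝓡 d).tangent ∞ (fun x =>
      (TotalSpace.mk' (EuclideanSpace ℝ (Fin d)) (b x) (v x) : TangentBundle (𝓡 d) Q)) x₀) :
    ContMDiffAt I 𝓘(ℝ, ℝ) ∞ (fun x => η (b x) (v x)) x₀ := by
  have hb : ContMDiffAt I (𝓡 d) ∞ b x₀ := by
    rw [contMDiffAt_totalSpace] at hv
    exact hv.1
  have h : ContMDiffAt I ((𝓡 d).prod 𝓘(ℝ, ℝ)) ∞
      (fun x => TotalSpace.mk' ℝ (E := Bundle.Trivial Q ℝ) (b x) (η (b x) (v x))) x₀ :=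
    ContMDiffAt.clm_bundle_apply (F₁ := EuclideanSpace ℝ (Fin d))
      (ContMDiffAt.comp x₀ (hη (b x₀)) hb) hv
  rw [contMDiffAt_totalSpace] at h
  exact h.2

end SmoothPairings

/-! ### 1-forms in charts and their exterior derivative -/

section ChartForms

variable {d : ℕ} {M : Type*} [TopologicalSpace M] [ChartedSpace (EuclideanSpace ℝ (Fin d)) M]
  [IsManifold (𝓡 d) ∞ M]

theorem contMDiffAt_extChartAt_symm_of_mem (x₀ : M) {y : EuclideanSpace ℝ (Fin d)}
    (hy : y ∈ (extChartAt (𝓡 d) x₀).target) :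
    ContMDiffAt 𝓘(ℝ, EuclideanSpace ℝ (Fin d)) (𝓡 d) ∞ (extChartAt (𝓡 d) x₀).symm y :=
  (contMDiffOn_extChartAt_symm x₀).contMDiffAt ((isOpen_extChartAt_target x₀).mem_nhds hy)

theorem SmoothForm.contDiffAt_chartForm {η : OneForm d M} (hη : SmoothForm η) (x₀ : M)
    {y : EuclideanSpace ℝ (Fin d)} (hy : y ∈ (extChartAt (𝓡 d) x₀).target) :
    ContDiffAt ℝ ∞ (chartForm η x₀) y := by
  suffices h : ContDiffOn ℝ ∞ (chartForm η x₀) (extChartAt (𝓡 d) x₀).target from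
    h.contDiffAt ((isOpen_extChartAt_target x₀).mem_nhds hy)
  -- In finite dimension it is enough to test on each fixed vector `w`; the value is then `η` paired
  -- with the smooth family obtained by pushing `w` forward through the inverse chart.
  rw [contDiffOn_clm_apply]
  intro w z hz
  refine ContDiffAt.contDiffWithinAt ?_
  rw [← contMDiffAt_iff_contDiffAt]
  refine hη.contMDiffAt_apply (fun z => (extChartAt (𝓡 d) x₀).symm z) _ ?_
  refine contMDiffAt_mfderiv_vector (I := 𝓘(ℝ, EuclideanSpace ℝ (Fin d)))
    (I' := 𝓘(ℝ, EuclideanSpace ℝ (Fin d))) (fun _ => (extChartAt (𝓡 d) x₀).symm) id (fun _ => w)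
    ?_ ?_
  · exact ContMDiffAt.comp (g := (extChartAt (𝓡 d) x₀).symm) (z, z)
      (contMDiffAt_extChartAt_symm_of_mem x₀ hz) contMDiffAt_snd
  · exact contMDiffAt_vectorSpace_iff_contDiffAt.2 contDiffAt_const

/-- In degree one the exterior derivative is the antisymmetrized derivative of the coefficients.
Later computations with `dη` use this coordinate expression. -/
theorem SmoothForm.extDerivForm_apply {η : OneForm d M} (hη : SmoothForm η) (x : M)
    (u v : TangentSpace (𝓡 d) x) :
    extDerivForm η x ![u, v] =
      fderiv ℝ (chartForm η x) (extChartAt (𝓡 d) x x)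
        (mfderiv (𝓡 d) 𝓘(ℝ, EuclideanSpace ℝ (Fin d)) (extChartAt (𝓡 d) x) x u)
        (mfderiv (𝓡 d) 𝓘(ℝ, EuclideanSpace ℝ (Fin d)) (extChartAt (𝓡 d) x) x v) -
      fderiv ℝ (chartForm η x) (extChartAt (𝓡 d) x x)
        (mfderiv (𝓡 d) 𝓘(ℝ, EuclideanSpace ℝ (Fin d)) (extChartAt (𝓡 d) x) x v)
        (mfderiv (𝓡 d) 𝓘(ℝ, EuclideanSpace ℝ (Fin d)) (extChartAt (𝓡 d) x) x u) := by
  have hω : DifferentiableAt ℝ (chartForm η x) (extChartAt (𝓡 d) x x) :=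
    (hη.contDiffAt_chartForm x (mem_extChartAt_target x)).differentiableAt (by simp)
  have hd : DifferentiableAt ℝ (fun y => ContinuousAlternatingMap.ofSubsingleton ℝ
      (EuclideanSpace ℝ (Fin d)) ℝ (0 : Fin 1) (chartForm η x y)) (extChartAt (𝓡 d) x x) :=
    (ContinuousAlternatingMap.ofSubsingletonLIE (𝕜 := ℝ) (E := EuclideanSpace ℝ (Fin d)) (F := ℝ)
      (0 : Fin 1)).toContinuousLinearEquiv.differentiableAt.comp _ hω
  have happ : ∀ w v, fderiv ℝ (fun y => chartForm η x y w) (extChartAt (𝓡 d) x x) v =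
      fderiv ℝ (chartForm η x) (extChartAt (𝓡 d) x x) v w := fun w v => by
    rw [fderiv_clm_apply hω (differentiableAt_const w)]
    simp
  have key : ∀ (D : EuclideanSpace ℝ (Fin d) →L[ℝ] EuclideanSpace ℝ (Fin d))
      (a b : EuclideanSpace ℝ (Fin d)),
      ((extDeriv (fun y => ContinuousAlternatingMap.ofSubsingleton ℝ (EuclideanSpace ℝ (Fin d)) ℝ
        (0 : Fin 1) (chartForm η x y)) (extChartAt (𝓡 d) x x)).compContinuousLinearMap D) ![a, b] =
      fderiv ℝ (chartForm η x) (extChartAt (𝓡 d) x x) (D a) (D b) -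
        fderiv ℝ (chartForm η x) (extChartAt (𝓡 d) x x) (D b) (D a) := fun D a b => by
    rw [ContinuousAlternatingMap.compContinuousLinearMap_apply, extDeriv_apply hd,
      Fin.sum_univ_two]
    simp only [ContinuousAlternatingMap.ofSubsingleton_apply_apply, happ]
    simp [Fin.removeNth, sub_eq_add_neg]
  exact key _ u v

theorem chartForm_mfderiv_extChartAt (η : OneForm d M) {x₀ z : M}
    (hz : z ∈ (extChartAt (𝓡 d) x₀).source) (w : TangentSpace (𝓡 d) z) :
    chartForm η x₀ (extChartAt (𝓡 d) x₀ z)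
      (mfderiv (𝓡 d) 𝓘(ℝ, EuclideanSpace ℝ (Fin d)) (extChartAt (𝓡 d) x₀) z w) = η z w := by
  have : IsManifold (𝓡 d) 1 M := .of_le (n := ∞) (by simp)
  have h := mfderivWithin_extChartAt_symm_comp_mfderiv_extChartAt' (I := 𝓡 d) hz
  rw [ModelWithCorners.range_eq_univ, mfderivWithin_univ] at h
  have h' := DFunLike.congr_fun h w
  -- The two covectors live over points that are equal only propositionally; every tangent space
  -- being the model space, the equation can be stated and follows by substitution.
  have e : ∀ z' : M, z' = z → ∀ w' : EuclideanSpace ℝ (Fin d),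
      (η z' : EuclideanSpace ℝ (Fin d) →L[ℝ] ℝ) w' =
        (η z : EuclideanSpace ℝ (Fin d) →L[ℝ] ℝ) w' := by
    rintro _ rfl _
    rfl
  exact (e _ ((extChartAt (𝓡 d) x₀).left_inv hz) _).trans (congrArg (η z) h')

omit [IsManifold (𝓡 d) ∞ M] in
theorem chartForm_smul (g : M → ℝ) (η : OneForm d M) (x₀ : M) :
    chartForm (fun x => g x • η x) x₀ =
      fun y => g ((extChartAt (𝓡 d) x₀).symm y) • chartForm η x₀ y := by
  funext y
  rfl

theorem SmoothForm.smul {η : OneForm d M} (hη : SmoothForm η) {g : M → ℝ}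
    (hg : ContMDiff (𝓡 d) 𝓘(ℝ, ℝ) ∞ g) : SmoothForm (fun x => g x • η x) :=
  ContMDiff.smul_section hg hη

/-- On `ker η`, the exterior derivative of `g η` is `g dη`. -/
theorem extDerivForm_smul_of_ker {η : OneForm d M} (hη : SmoothForm η) {g : M → ℝ}
    (hg : ContMDiff (𝓡 d) 𝓘(ℝ, ℝ) ∞ g) (x : M) (u v : TangentSpace (𝓡 d) x) (hu : η x u = 0)
    (hv : η x v = 0) :
    extDerivForm (fun x => g x • η x) x ![u, v] = g x * extDerivForm η x ![u, v] := by
  have hω : DifferentiableAt ℝ (chartForm η x) (extChartAt (𝓡 d) x x) :=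
    (hη.contDiffAt_chartForm x (mem_extChartAt_target x)).differentiableAt (by simp)
  have hg' : DifferentiableAt ℝ (fun y => g ((extChartAt (𝓡 d) x).symm y))
      (extChartAt (𝓡 d) x x) := by
    have := ContMDiffAt.comp (extChartAt (𝓡 d) x x) (hg _)
      (contMDiffAt_extChartAt_symm_of_mem x (mem_extChartAt_target x))
    exact (contMDiffAt_iff_contDiffAt.1 this).differentiableAt (by simp)
  -- The product rule adds the term `dg ∧ η`, which vanishes on a pair of vectors of `ker η`.
  have key : ∀ u' v' : EuclideanSpace ℝ (Fin d),
      chartForm η x (extChartAt (𝓡 d) x x) u' = 0 → chartForm η x (extChartAt (𝓡 d) x x) v' = 0 →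
      fderiv ℝ (fun y => g ((extChartAt (𝓡 d) x).symm y) • chartForm η x y)
          (extChartAt (𝓡 d) x x) u' v' -
        fderiv ℝ (fun y => g ((extChartAt (𝓡 d) x).symm y) • chartForm η x y)
          (extChartAt (𝓡 d) x x) v' u' =
      g x * (fderiv ℝ (chartForm η x) (extChartAt (𝓡 d) x x) u' v' -
        fderiv ℝ (chartForm η x) (extChartAt (𝓡 d) x x) v' u') := fun u' v' hu' hv' => by
    rw [fderiv_fun_smul hg' hω]
    simp only [add_apply, smul_apply, ContinuousLinearMap.smulRight_apply, smul_eq_mul, hu', hv',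
      extChartAt_to_inv]
    ring
  rw [(hη.smul hg).extDerivForm_apply, hη.extDerivForm_apply, chartForm_smul]
  exact key _ _ ((chartForm_mfderiv_extChartAt η (mem_extChartAt_source x) u).trans hu)
    ((chartForm_mfderiv_extChartAt η (mem_extChartAt_source x) v).trans hv)

end ChartForms

/-! ### Cartan's formula for an invariant form -/

section Cartan

variable {S E : Type*} [NormedAddCommGroup S] [NormedSpace ℝ S] [NormedAddCommGroup E]
  [NormedSpace ℝ E]

/-- If `α` is invariant under a family of local diffeomorphisms `F s` with `F s₀ = id`, then
`d(α(X)) = -dα(X, ·)` for the velocity `X` of the family at `s₀` in the direction `ξ`. -/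
theorem fderiv_contraction_of_invariant {α : E → E →L[ℝ] ℝ} {F : S × E → E} {s₀ : S} {p : E}
    (hα : DifferentiableAt ℝ α p) (hF : ContDiffAt ℝ 2 F (s₀, p))
    (hid : ∀ᶠ y in 𝓝 p, F (s₀, y) = y)
    (hinv : ∀ᶠ s in 𝓝 s₀, ∀ w, α (F (s, p)) (fderiv ℝ F (s, p) (0, w)) = α p w) (ξ : S) (v : E) :
    fderiv ℝ (fun y => α y (fderiv ℝ F (s₀, y) (ξ, 0))) p v =
      -(fderiv ℝ α p (fderiv ℝ F (s₀, p) (ξ, 0)) v -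
        fderiv ℝ α p v (fderiv ℝ F (s₀, p) (ξ, 0))) := by
  have hF1 : HasFDerivAt F (fderiv ℝ F (s₀, p)) (s₀, p) :=
    (hF.differentiableAt (by simp)).hasFDerivAt
  have hF2 : HasFDerivAt (fderiv ℝ F) (fderiv ℝ (fderiv ℝ F) (s₀, p)) (s₀, p) :=
    ((hF.fderiv_right (m := 1) (by norm_num)).differentiableAt (by simp)).hasFDerivAt
  -- Differentiating the contraction in the direction `v` (`h1`) and the invariance identity in the
  -- direction `ξ` (`h4`) produces the same mixed second derivative of `F`, by symmetry; eliminating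
  -- it gives the formula without any flow.
  have hsymm := hF.isSymmSndFDerivAt (by simp) (ξ, 0) (0, v)
  have hp : F (s₀, p) = p := hid.self_of_nhds
  have hr : HasFDerivAt (fun y : E => (s₀, y)) (ContinuousLinearMap.inr ℝ S E) p :=
    hasFDerivAt_prodMk_right s₀ p
  have hl : HasFDerivAt (fun s : S => (s, p)) (ContinuousLinearMap.inl ℝ S E) s₀ :=
    hasFDerivAt_prodMk_left s₀ p
  have hv : fderiv ℝ F (s₀, p) (0, v) = v := by
    have h1 : HasFDerivAt (fun y => F (s₀, y)) _ p := HasFDerivAt.comp p hF1 hr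
    have h2 : HasFDerivAt (fun y => F (s₀, y)) (ContinuousLinearMap.id ℝ E) p :=
      (hasFDerivAt_id p).congr_of_eventuallyEq hid
    simpa using DFunLike.congr_fun (h1.unique h2) v
  have hX : HasFDerivAt (fun y => fderiv ℝ F (s₀, y) (ξ, 0)) _ p :=
    (HasFDerivAt.comp p hF2 hr).clm_apply (hasFDerivAt_const ((ξ, 0) : S × E) p)
  have h1 := (hα.hasFDerivAt.clm_apply hX).fderiv
  have hα' : HasFDerivAt α (fderiv ℝ α p) (F (s₀, p)) := by
    rw [hp]
    exact hα.hasFDerivAt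
  have h2 : HasFDerivAt (fun s => α (F (s, p)) (fderiv ℝ F (s, p) (0, v))) _ s₀ :=
    (HasFDerivAt.comp (f := fun s => F (s, p)) s₀ hα' (HasFDerivAt.comp s₀ hF1 hl)).clm_apply
      ((HasFDerivAt.comp s₀ hF2 hl).clm_apply (hasFDerivAt_const ((0, v) : S × E) s₀))
  have h3 : HasFDerivAt (fun s => α (F (s, p)) (fderiv ℝ F (s, p) (0, v))) (0 : S →L[ℝ] ℝ) s₀ :=
    (hasFDerivAt_const (α p v) s₀).congr_of_eventuallyEq (hinv.mono fun s hs => hs v)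
  have h4 := DFunLike.congr_fun (h2.unique h3) ξ
  have h5 := DFunLike.congr_fun h1 v
  simp [hv, hp] at h4 h5
  rw [h5]
  rw [hsymm] at h4
  linarith

/-- Chain rules produce derivatives at `1 • x` or at `φ.symm (φ x)`; this moves them to the intended
base point, both sides being read in the model space. -/
theorem mfderiv_apply_congr_point {k d : ℕ} {M N : Type*} [TopologicalSpace M]
    [ChartedSpace (EuclideanSpace ℝ (Fin d)) M] [TopologicalSpace N]
    [ChartedSpace (EuclideanSpace ℝ (Fin k)) N] (g : N → M) {a b : N} (h : a = b)
    (u : EuclideanSpace ℝ (Fin k)) :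
    (mfderiv (𝓡 k) (𝓡 d) g a u : EuclideanSpace ℝ (Fin d)) =
      (mfderiv (𝓡 k) (𝓡 d) g b u : EuclideanSpace ℝ (Fin d)) := by
  subst h
  rfl

variable {k d : ℕ} {M A : Type*} [TopologicalSpace M] [ChartedSpace (EuclideanSpace ℝ (Fin d)) M]
  [IsManifold (𝓡 d) ∞ M] [Group A] [TopologicalSpace A]
  [ChartedSpace (EuclideanSpace ℝ (Fin k)) A] [IsManifold (𝓡 k) ∞ A] [MulAction A M]
  [ContMDiffSMul (𝓡 k) (𝓡 d) ∞ A M]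

/-- Cartan's formula for an invariant 1-form: `d(η(X)) = -dη(X, ·)` for every fundamental vector
field `X` of a smooth action that preserves `η`. -/
theorem mfderiv_contraction_of_invariant {η : OneForm d M} (hη : SmoothForm η)
    (hinv : ∀ (a : A) x (v : TangentSpace (𝓡 d) x),
      η (a • x) (mfderiv (𝓡 d) (𝓡 d) (fun y : M => a • y) x v) = η x v)
    (ξ : TangentSpace (𝓡 k) (1 : A)) (x : M) (v : TangentSpace (𝓡 d) x) :
    mfderiv (𝓡 d) 𝓘(ℝ, ℝ) (fun y => η y (fundamentalField ξ y)) x v =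
      -extDerivForm η x ![fundamentalField ξ x, v] := by
  have : IsManifold (𝓡 d) 1 M := .of_le (n := ∞) (by simp)
  have : IsManifold (𝓡 k) 1 A := .of_le (n := ∞) (by simp)
  set φ := extChartAt (𝓡 d) x with hφ
  set ψ := extChartAt (𝓡 k) (1 : A) with hψ
  set p := φ x
  set s₀ := ψ 1
  have hpt : p ∈ φ.target := mem_extChartAt_target x
  have hst : s₀ ∈ ψ.target := mem_extChartAt_target (1 : A)
  have hφp : φ.symm p = x := extChartAt_to_inv x
  have hψs : ψ.symm s₀ = 1 := extChartAt_to_inv (1 : A)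
  have hφo : IsOpen φ.target := isOpen_extChartAt_target x
  have hψo : IsOpen ψ.target := isOpen_extChartAt_target (1 : A)
  -- the action in coordinates, without and with the chart on the target
  let Φ : EuclideanSpace ℝ (Fin k) × EuclideanSpace ℝ (Fin d) → M :=
    fun q => ψ.symm q.1 • φ.symm q.2
  let F : EuclideanSpace ℝ (Fin k) × EuclideanSpace ℝ (Fin d) → EuclideanSpace ℝ (Fin d) :=
    fun q => φ (Φ q)
  have hΦ : ∀ q : EuclideanSpace ℝ (Fin k) × EuclideanSpace ℝ (Fin d), q.1 ∈ ψ.target →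
      q.2 ∈ φ.target → ContMDiffAt 𝓘(ℝ, EuclideanSpace ℝ (Fin k) × EuclideanSpace ℝ (Fin d))
        (𝓡 d) ∞ Φ q := by
    intro q h1 h2
    have e1 : ContMDiffAt 𝓘(ℝ, EuclideanSpace ℝ (Fin k) × EuclideanSpace ℝ (Fin d)) (𝓡 k) ∞
        (fun q : EuclideanSpace ℝ (Fin k) × EuclideanSpace ℝ (Fin d) => ψ.symm q.1) q :=
      ContMDiffAt.comp q (contMDiffAt_extChartAt_symm_of_mem (1 : A) h1) contDiffAt_fst.contMDiffAt
    have e2 : ContMDiffAt 𝓘(ℝ, EuclideanSpace ℝ (Fin k) × EuclideanSpace ℝ (Fin d)) (𝓡 d) ∞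
        (fun q : EuclideanSpace ℝ (Fin k) × EuclideanSpace ℝ (Fin d) => φ.symm q.2) q :=
      ContMDiffAt.comp q (contMDiffAt_extChartAt_symm_of_mem x h2) contDiffAt_snd.contMDiffAt
    exact e1.smul e2
  have hF : ∀ q : EuclideanSpace ℝ (Fin k) × EuclideanSpace ℝ (Fin d), q.1 ∈ ψ.target →
      q.2 ∈ φ.target → Φ q ∈ φ.source → ContDiffAt ℝ ∞ F q := by
    intro q h1 h2 h3
    rw [← contMDiffAt_iff_contDiffAt]
    exact ContMDiffAt.comp q (contMDiffAt_extChartAt' (by simpa [hφ] using h3)) (hΦ q h1 h2)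
  have hΦs : ∀ y ∈ φ.target, Φ (s₀, y) = φ.symm y := fun y _ => by
    change ψ.symm s₀ • φ.symm y = φ.symm y
    rw [hψs, one_smul]
  have hFd : ∀ q : EuclideanSpace ℝ (Fin k) × EuclideanSpace ℝ (Fin d), q.1 ∈ ψ.target →
      q.2 ∈ φ.target → Φ q ∈ φ.source → ∀ u, fderiv ℝ F q u =
        (mfderiv (𝓡 d) 𝓘(ℝ, EuclideanSpace ℝ (Fin d)) φ (Φ q)
          (mfderiv 𝓘(ℝ, EuclideanSpace ℝ (Fin k) × EuclideanSpace ℝ (Fin d)) (𝓡 d) Φ q u) :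
          EuclideanSpace ℝ (Fin d)) := by
    intro q h1 h2 h3 u
    have := mfderiv_comp q (mdifferentiableAt_extChartAt (I := 𝓡 d) (by simpa [hφ] using h3))
      ((hΦ q h1 h2).mdifferentiableAt (by simp))
    rw [← mfderiv_eq_fderiv]
    exact DFunLike.congr_fun this u
  -- The chart's differential inside the derivative of `F` cancels against the inverse chart inside
  -- `chartForm`, so coordinate pairings become pairings with `η` on `M`.
  have hpair : ∀ q : EuclideanSpace ℝ (Fin k) × EuclideanSpace ℝ (Fin d), q.1 ∈ ψ.target →
      q.2 ∈ φ.target → Φ q ∈ φ.source → ∀ u, chartForm η x (F q) (fderiv ℝ F q u) =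
        η (Φ q) (mfderiv 𝓘(ℝ, EuclideanSpace ℝ (Fin k) × EuclideanSpace ℝ (Fin d)) (𝓡 d) Φ q u) := by
    intro q h1 h2 h3 u
    rw [← chartForm_mfderiv_extChartAt η h3]
    exact congrArg (chartForm η x (F q)) (hFd q h1 h2 h3 u)
  have hXi : ∀ y ∈ φ.target, ∀ u : EuclideanSpace ℝ (Fin k),
      (mfderiv 𝓘(ℝ, EuclideanSpace ℝ (Fin k) × EuclideanSpace ℝ (Fin d)) (𝓡 d) Φ (s₀, y) (u, 0) :
        EuclideanSpace ℝ (Fin d)) =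
        (mfderiv (𝓡 k) (𝓡 d) (fun a : A => a • φ.symm y) 1
          (mfderiv 𝓘(ℝ, EuclideanSpace ℝ (Fin k)) (𝓡 k) ψ.symm s₀ u :
            EuclideanSpace ℝ (Fin k)) : EuclideanSpace ℝ (Fin d)) := by
    intro y hy u
    have h1 := mfderiv_comp (f := fun s : EuclideanSpace ℝ (Fin k) => (s, y)) (g := Φ)
      (I := 𝓘(ℝ, EuclideanSpace ℝ (Fin k)))
      (I' := 𝓘(ℝ, EuclideanSpace ℝ (Fin k) × EuclideanSpace ℝ (Fin d))) (I'' := 𝓡 d) s₀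
      ((hΦ (s₀, y) hst hy).mdifferentiableAt (by simp))
      (hasFDerivAt_prodMk_left s₀ y).differentiableAt.mdifferentiableAt
    have h2 := mfderiv_comp_of_eq (f := ψ.symm) (g := fun a : A => a • φ.symm y)
      (I := 𝓘(ℝ, EuclideanSpace ℝ (Fin k))) (I' := 𝓡 k) (I'' := 𝓡 d) (x := s₀) (y := 1)
      ((contMDiffAt_id.smul contMDiffAt_const).mdifferentiableAt (n := ∞) (by simp))
      ((contMDiffAt_extChartAt_symm_of_mem (1 : A) hst).mdifferentiableAt (by simp)) hψs
    rw [mfderiv_eq_fderiv, (hasFDerivAt_prodMk_left s₀ y).fderiv] at h1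
    exact (DFunLike.congr_fun h1 u).symm.trans ((DFunLike.congr_fun h2 u).trans
      (mfderiv_apply_congr_point _ hψs _))
  have hΦv : ∀ s ∈ ψ.target, ∀ w : EuclideanSpace ℝ (Fin d),
      (mfderiv 𝓘(ℝ, EuclideanSpace ℝ (Fin k) × EuclideanSpace ℝ (Fin d)) (𝓡 d) Φ (s, p) (0, w) :
        EuclideanSpace ℝ (Fin d)) =
        (mfderiv (𝓡 d) (𝓡 d) (fun y : M => ψ.symm s • y) x
          (mfderiv 𝓘(ℝ, EuclideanSpace ℝ (Fin d)) (𝓡 d) φ.symm p w :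
            EuclideanSpace ℝ (Fin d)) : EuclideanSpace ℝ (Fin d)) := by
    intro s hs w
    have h1 := mfderiv_comp (f := fun y : EuclideanSpace ℝ (Fin d) => (s, y)) (g := Φ)
      (I := 𝓘(ℝ, EuclideanSpace ℝ (Fin d)))
      (I' := 𝓘(ℝ, EuclideanSpace ℝ (Fin k) × EuclideanSpace ℝ (Fin d))) (I'' := 𝓡 d) p
      ((hΦ (s, p) hs hpt).mdifferentiableAt (by simp))
      (hasFDerivAt_prodMk_right s p).differentiableAt.mdifferentiableAt
    have h2 := mfderiv_comp_of_eq (f := φ.symm) (g := fun y : M => ψ.symm s • y)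
      (I := 𝓘(ℝ, EuclideanSpace ℝ (Fin d))) (I' := 𝓡 d) (I'' := 𝓡 d) (x := p) (y := x)
      ((ContMDiffSMul.contMDiff_const_smul (I := 𝓡 k) (n := ∞) (ψ.symm s) x).mdifferentiableAt
        (by simp))
      ((contMDiffAt_extChartAt_symm_of_mem x hpt).mdifferentiableAt (by simp)) hφp
    rw [mfderiv_eq_fderiv, (hasFDerivAt_prodMk_right s p).fderiv] at h1
    exact (DFunLike.congr_fun h1 w).symm.trans ((DFunLike.congr_fun h2 w).trans
      (mfderiv_apply_congr_point _ hφp _))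
  let ξ' : EuclideanSpace ℝ (Fin k) := mfderiv (𝓡 k) 𝓘(ℝ, EuclideanSpace ℝ (Fin k)) ψ 1 ξ
  let v' : EuclideanSpace ℝ (Fin d) := mfderiv (𝓡 d) 𝓘(ℝ, EuclideanSpace ℝ (Fin d)) φ x v
  have hξ : (mfderiv 𝓘(ℝ, EuclideanSpace ℝ (Fin k)) (𝓡 k) ψ.symm s₀ ξ' :
      EuclideanSpace ℝ (Fin k)) = ξ := by
    have h := mfderivWithin_extChartAt_symm_comp_mfderiv_extChartAt' (I := 𝓡 k)
      (mem_extChartAt_source (I := 𝓡 k) (1 : A))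
    rw [ModelWithCorners.range_eq_univ, mfderivWithin_univ] at h
    exact DFunLike.congr_fun h ξ
  have hXξ : ∀ y ∈ φ.target,
      (mfderiv 𝓘(ℝ, EuclideanSpace ℝ (Fin k) × EuclideanSpace ℝ (Fin d)) (𝓡 d) Φ (s₀, y) (ξ', 0) :
        EuclideanSpace ℝ (Fin d)) = fundamentalField ξ (φ.symm y) := fun y hy => by
    rw [hXi y hy, hξ]
    rfl
  have ηcast : ∀ z z' : M, z = z' → ∀ w : EuclideanSpace ℝ (Fin d),
      (η z : EuclideanSpace ℝ (Fin d) →L[ℝ] ℝ) w =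
        (η z' : EuclideanSpace ℝ (Fin d) →L[ℝ] ℝ) w := by
    rintro _ _ rfl _
    rfl
  have φcast : ∀ z z' : M, z = z' → ∀ w : EuclideanSpace ℝ (Fin d),
      (mfderiv (𝓡 d) 𝓘(ℝ, EuclideanSpace ℝ (Fin d)) φ z w : EuclideanSpace ℝ (Fin d)) =
        (mfderiv (𝓡 d) 𝓘(ℝ, EuclideanSpace ℝ (Fin d)) φ z' w : EuclideanSpace ℝ (Fin d)) := by
    rintro _ _ rfl _
    rfl
  have hFp : ∀ y ∈ φ.target, F (s₀, y) = y := fun y hy => by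
    change φ (Φ (s₀, y)) = y
    rw [hΦs y hy, φ.right_inv hy]
  have hsrc : ∀ y ∈ φ.target, Φ (s₀, y) ∈ φ.source := fun y hy => by
    rw [hΦs y hy]
    exact φ.map_target hy
  have hFsm : ContDiffAt ℝ ∞ F (s₀, p) := hF _ hst hpt (hsrc p hpt)
  have hωd : ContDiffAt ℝ ∞ (chartForm η x) p := hη.contDiffAt_chartForm x hpt
  have key := fderiv_contraction_of_invariant (α := chartForm η x) (F := F) (s₀ := s₀) (p := p)
    (hωd.differentiableAt (by simp)) (hFsm.of_le (by norm_cast))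
    (by filter_upwards [hφo.mem_nhds hpt] with y hy using hFp y hy)
    (by
      -- For `s` near `s₀` the point `Φ (s, p)` stays in the source of the chart, where `hpair`
      -- turns the required identity into invariance of `η` under `ψ.symm s`.
      have hc : ContinuousAt (fun s => Φ (s, p)) s₀ :=
        ContinuousAt.comp (f := fun s => (s, p)) (hΦ (s₀, p) hst hpt).continuousAt
          (Continuous.continuousAt (by fun_prop))
      filter_upwards [hψo.mem_nhds hst,
        hc.preimage_mem_nhds ((isOpen_extChartAt_source x).mem_nhds (hsrc p hpt))] with s hs hs' w
      rw [hpair (s, p) hs hpt hs' (0, w)]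
      refine (congrArg (η (Φ (s, p))) (hΦv s hs w)).trans ?_
      refine (ηcast _ (ψ.symm s • x) (congrArg (ψ.symm s • ·) hφp) _).trans ?_
      refine (hinv (ψ.symm s) x _).trans ?_
      exact ηcast x (φ.symm p) hφp.symm _) ξ' v'
  have hX0 : fderiv ℝ F (s₀, p) (ξ', 0) = (mfderiv (𝓡 d) 𝓘(ℝ, EuclideanSpace ℝ (Fin d)) φ x
      (fundamentalField ξ x) : EuclideanSpace ℝ (Fin d)) := by
    refine (hFd (s₀, p) hst hpt (hsrc p hpt) (ξ', 0)).trans ?_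
    refine (φcast _ x ((hΦs p hpt).trans hφp) _).trans ?_
    refine congrArg (mfderiv (𝓡 d) 𝓘(ℝ, EuclideanSpace ℝ (Fin d)) φ x) ((hXξ p hpt).trans ?_)
    exact congrArg (fun z => (fundamentalField ξ z : EuclideanSpace ℝ (Fin d))) hφp
  -- Near `x` the function `η(X_ξ)` is the coordinate contraction of `key`, read through the chart.
  have hh : (fun y => η y (fundamentalField ξ y)) =ᶠ[𝓝 x]
      (fun y => chartForm η x y (fderiv ℝ F (s₀, y) (ξ', 0))) ∘ φ := by
    filter_upwards [(isOpen_extChartAt_source x).mem_nhds (mem_extChartAt_source (I := 𝓡 d) x)]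
      with y hy
    have hy' : φ y ∈ φ.target := φ.map_source hy
    have hyΦ : Φ (s₀, φ y) = y := (hΦs _ hy').trans (φ.left_inv hy)
    have h1 := hpair (s₀, φ y) hst hy' (hsrc _ hy') (ξ', 0)
    rw [hFp _ hy'] at h1
    refine Eq.trans ?_ h1.symm
    refine Eq.trans ?_ (congrArg (η (Φ (s₀, φ y))) (hXξ _ hy')).symm
    refine Eq.trans ?_ (ηcast y _ hyΦ.symm _)
    rw [φ.left_inv hy]
  have hHd : DifferentiableAt ℝ (fun y => chartForm η x y (fderiv ℝ F (s₀, y) (ξ', 0))) p := by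
    refine (hωd.differentiableAt (by simp)).clm_apply ?_
    have h1 : DifferentiableAt ℝ (fderiv ℝ F) (s₀, p) :=
      (hFsm.fderiv_right (m := ∞) (by simp)).differentiableAt (by simp)
    exact (DifferentiableAt.comp (f := fun y => (s₀, y)) p h1
      (hasFDerivAt_prodMk_right s₀ p).differentiableAt).clm_apply (differentiableAt_const _)
  rw [hh.mfderiv_eq, hη.extDerivForm_apply]
  rw [hX0] at key
  have hcomp := mfderiv_comp x (hHd.mdifferentiableAt)
    (mdifferentiableAt_extChartAt (I := 𝓡 d) (mem_chart_source _ x))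
  rw [mfderiv_eq_fderiv] at hcomp
  exact (DFunLike.congr_fun hcomp v).trans key

end Cartan

/-! ### Smooth dependence of integrals on parameters -/

section ParametricIntegral

open MeasureTheory

variable {k d : ℕ} {A : Type*} [TopologicalSpace A] [ChartedSpace (EuclideanSpace ℝ (Fin k)) A]
  [IsManifold (𝓡 k) ∞ A]

theorem contMDiffOn_fderiv_param {V : Type} [NormedAddCommGroup V] [NormedSpace ℝ V]
    {U : Set (EuclideanSpace ℝ (Fin d))} (hU : IsOpen U) {F : A → EuclideanSpace ℝ (Fin d) → V}
    (hF : ContMDiffOn ((𝓡 k).prod 𝓘(ℝ, EuclideanSpace ℝ (Fin d))) 𝓘(ℝ, V) ∞ (Function.uncurry F)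
      (Set.univ ×ˢ U)) :
    ContMDiffOn ((𝓡 k).prod 𝓘(ℝ, EuclideanSpace ℝ (Fin d)))
      𝓘(ℝ, EuclideanSpace ℝ (Fin d) →L[ℝ] V) ∞
      (Function.uncurry fun a y => fderiv ℝ (F a) y) (Set.univ ×ˢ U) := by
  rintro ⟨a, y⟩ ⟨-, hy⟩
  have hFa : ContMDiffAt ((𝓡 k).prod 𝓘(ℝ, EuclideanSpace ℝ (Fin d))) 𝓘(ℝ, V) ∞
      (Function.uncurry F) (a, y) :=
    hF.contMDiffAt ((isOpen_univ.prod hU).mem_nhds ⟨trivial, hy⟩)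
  have h := ContMDiffAt.mfderiv (J := (𝓡 k).prod 𝓘(ℝ, EuclideanSpace ℝ (Fin d)))
    (I := 𝓘(ℝ, EuclideanSpace ℝ (Fin d)))
    (I' := 𝓘(ℝ, V)) (m := ∞) (n := ∞) (x₀ := (a, y))
    (fun (p : A × EuclideanSpace ℝ (Fin d)) z => F p.1 z) Prod.snd
    (ContMDiffAt.comp (g := Function.uncurry F)
      (f := fun q : (A × EuclideanSpace ℝ (Fin d)) × EuclideanSpace ℝ (Fin d) => (q.1.1, q.2))
      ((a, y), y) hFa (contMDiffAt_fst.fst.prodMk contMDiffAt_snd)) contMDiffAt_snd (by simp)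
  refine ContMDiffAt.contMDiffWithinAt ?_
  simp only [inTangentCoordinates_model_space, mfderiv_eq_fderiv] at h
  exact h

variable [T2Space A] [MeasurableSpace A] [BorelSpace A] (μ : Measure A)
  [IsFiniteMeasureOnCompacts μ]

/-- Differentiation under the integral sign. The dominating function is a constant: a bound for the
derivative on the compact product of `L` with a closed ball inside `U`. -/
theorem hasFDerivAt_setIntegral_param {V : Type} [NormedAddCommGroup V] [NormedSpace ℝ V]
    {U : Set (EuclideanSpace ℝ (Fin d))} (hU : IsOpen U) {F : A → EuclideanSpace ℝ (Fin d) → V}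
    (hF : ContMDiffOn ((𝓡 k).prod 𝓘(ℝ, EuclideanSpace ℝ (Fin d))) 𝓘(ℝ, V) ∞ (Function.uncurry F)
      (Set.univ ×ˢ U)) {L : Set A} (hL : IsCompact L) {y₀ : EuclideanSpace ℝ (Fin d)}
    (hy₀ : y₀ ∈ U) :
    HasFDerivAt (fun y => ∫ a in L, F a y ∂μ) (∫ a in L, fderiv ℝ (F a) y₀ ∂μ) y₀ := by
  obtain ⟨r, hr, hrU⟩ := Metric.nhds_basis_closedBall.mem_iff.1 (hU.mem_nhds hy₀)
  have hF' := contMDiffOn_fderiv_param hU hF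
  have hcF : ∀ y ∈ U, Continuous fun a => F a y := fun y hy => by
    rw [← continuousOn_univ]
    exact hF.continuousOn.comp (f := fun a => (a, y)) (by fun_prop) (fun a _ => ⟨trivial, hy⟩)
  have hcF' : ∀ y ∈ U, Continuous fun a => fderiv ℝ (F a) y := fun y hy => by
    rw [← continuousOn_univ]
    exact hF'.continuousOn.comp (f := fun a => (a, y)) (by fun_prop) (fun a _ => ⟨trivial, hy⟩)
  obtain ⟨C, hC⟩ := (hL.prod (isCompact_closedBall y₀ r)).exists_bound_of_continuousOn
    (hF'.continuousOn.mono (Set.prod_mono (Set.subset_univ _) hrU))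
  have : IsFiniteMeasure (μ.restrict L) := ⟨by simpa using hL.measure_lt_top⟩
  refine hasFDerivAt_integral_of_dominated_of_fderiv_le (bound := fun _ => C)
    (F' := fun y a => fderiv ℝ (F a) y) (Metric.closedBall_mem_nhds y₀ hr) ?_ ?_ ?_ ?_
    (integrable_const C) ?_
  · filter_upwards [hU.mem_nhds hy₀] with y hy
    exact (hcF y hy).continuousOn.aestronglyMeasurable_of_isCompact hL hL.measurableSet
  · exact (hcF y₀ hy₀).continuousOn.integrableOn_compact hL
  · exact (hcF' y₀ hy₀).continuousOn.aestronglyMeasurable_of_isCompact hL hL.measurableSet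
  · filter_upwards [ae_restrict_mem hL.measurableSet] with a ha y hy using hC (a, y) ⟨ha, hy⟩
  · refine Filter.Eventually.of_forall fun a y hy => ?_
    have h1 : ContMDiffAt 𝓘(ℝ, EuclideanSpace ℝ (Fin d)) 𝓘(ℝ, V) ∞ (F a) y :=
      ContMDiffAt.comp (g := Function.uncurry F) (f := fun y => (a, y)) y
        (hF.contMDiffAt ((isOpen_univ.prod hU).mem_nhds ⟨trivial, hrU hy⟩))
        (contMDiffAt_const.prodMk contMDiffAt_id)
    exact ((contMDiffAt_iff_contDiffAt.1 h1).differentiableAt (by simp)).hasFDerivAt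

/-- Integrals over a compact set of a smooth function depend smoothly on parameters. -/
theorem contDiffOn_setIntegral_param {U : Set (EuclideanSpace ℝ (Fin d))} (hU : IsOpen U)
    {L : Set A} (hL : IsCompact L) (m : ℕ) : ∀ {V : Type} [NormedAddCommGroup V]
    [NormedSpace ℝ V] {F : A → EuclideanSpace ℝ (Fin d) → V},
    ContMDiffOn ((𝓡 k).prod 𝓘(ℝ, EuclideanSpace ℝ (Fin d))) 𝓘(ℝ, V) ∞ (Function.uncurry F)
      (Set.univ ×ˢ U) → ContDiffOn ℝ m (fun y => ∫ a in L, F a y ∂μ) U := by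
  -- The target `V` must vary in the induction, since the derivative takes values in linear maps
  -- into `V`.
  induction m with
  | zero =>
    intro V _ _ F hF
    exact contDiffOn_zero.2 fun y hy =>
      (hasFDerivAt_setIntegral_param μ hU hF hL hy).continuousAt.continuousWithinAt
  | succ m ih =>
    intro V _ _ F hF
    have hd := fun y (hy : y ∈ U) => hasFDerivAt_setIntegral_param μ hU hF hL hy
    push_cast
    rw [contDiffOn_succ_iff_fderiv_of_isOpen hU]
    refine ⟨fun y hy => (hd y hy).differentiableAt.differentiableWithinAt, by simp, ?_⟩
    exact (ih (contMDiffOn_fderiv_param hU hF)).congr fun y hy => (hd y hy).fderiv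

end ParametricIntegral

/-! ### Cutoff functions for proper actions -/

section Cutoff

open scoped Pointwise

/-- Properness makes the orbit space Hausdorff; local compactness and σ-compactness pass to it along
the open quotient map. -/
theorem paracompactSpace_quotient_of_properSMul {A M : Type*} [Group A] [TopologicalSpace A]
    [TopologicalSpace M] [MulAction A M] [ProperSMul A M] [WeaklyLocallyCompactSpace M]
    [SigmaCompactSpace M] : ParacompactSpace (Quotient (MulAction.orbitRel A M)) := by
  have hpr := MulAction.isOpenQuotientMap_quotientMk (Γ := A) (T := M)
  have : WeaklyLocallyCompactSpace (Quotient (MulAction.orbitRel A M)) := ⟨fun q => by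
    obtain ⟨x, rfl⟩ := hpr.surjective q
    obtain ⟨K, hK, hx⟩ := exists_compact_mem_nhds x
    exact ⟨_, hK.image hpr.continuous, hpr.isOpenMap.image_mem_nhds hx⟩⟩
  have : SigmaCompactSpace (Quotient (MulAction.orbitRel A M)) := by
    rw [← isSigmaCompact_univ_iff, ← hpr.surjective.range_eq]
    exact isSigmaCompact_range hpr.continuous
  infer_instance

variable {d : ℕ} {A M : Type*} [Group A] [TopologicalSpace A] [TopologicalSpace M] [T2Space M]
  [SecondCountableTopology M] [ChartedSpace (EuclideanSpace ℝ (Fin d)) M] [IsManifold (𝓡 d) ∞ M]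
  [MulAction A M] [ProperSMul A M]

variable (d A M) in
/-- A proper action admits a smooth function that is nonzero somewhere on each orbit and whose
restriction to orbits is compactly supported, locally uniformly. -/
theorem exists_cutoff_of_properSMul : ∃ χ : M → ℝ, ContMDiff (𝓡 d) 𝓘(ℝ, ℝ) ∞ χ ∧
    (∀ x, 0 ≤ χ x) ∧ (∀ x, ∃ a : A, χ (a • x) ≠ 0) ∧
    ∀ x, ∃ N ∈ 𝓝 x, ∃ L : Set A, IsCompact L ∧ ∀ y ∈ N, ∀ a ∉ L, χ (a • y) = 0 := by
  have : LocallyCompactSpace M := ChartedSpace.locallyCompactSpace (EuclideanSpace ℝ (Fin d)) M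
  have := paracompactSpace_quotient_of_properSMul (A := A) (M := M)
  let pr : M → Quotient (MulAction.orbitRel A M) := Quotient.mk _
  have hpr : IsOpenQuotientMap pr := MulAction.isOpenQuotientMap_quotientMk
  have hprsmul : ∀ (a : A) x, pr (a • x) = pr x := fun a x =>
    Quotient.sound (MulAction.mem_orbit x a)
  choose K hK hKx using fun x : M => exists_compact_mem_nhds x
  -- Local finiteness is arranged on the orbit space rather than on `M`, so that it is uniform along
  -- orbits. Each `v x` stays inside the image of `interior (K x)`.
  obtain ⟨v, hvo, hvc, hvf, hvs⟩ := precise_refinement (fun x => pr '' interior (K x))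
    (fun x => hpr.isOpenMap _ isOpen_interior) (Set.iUnion_eq_univ_iff.2 fun q => by
      obtain ⟨x, rfl⟩ := hpr.surjective q
      exact ⟨x, Set.mem_image_of_mem _ (mem_interior_iff_mem_nhds.2 (hKx x))⟩)
  have hex : ∀ x : M, ∃ f : M → ℝ, f.support = interior (K x) ∩ pr ⁻¹' v x ∧
      ContMDiff (𝓡 d) 𝓘(ℝ, ℝ) ∞ f ∧ ∀ y, 0 ≤ f y := fun x =>
    (isOpen_interior.inter ((hvo x).preimage hpr.continuous)).exists_contMDiff_support_eq (𝓡 d)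
  choose f hfs hfc hf0 using hex
  have hlf : LocallyFinite fun x => Function.support (f x) :=
    (hvf.preimage_continuous hpr.continuous).subset fun x => by
      rw [hfs]
      exact Set.inter_subset_right
  refine ⟨fun y => ∑ᶠ x, f x y, contMDiff_finsum hfc hlf, fun y => finsum_nonneg fun x => hf0 x y,
    fun y => ?_, fun x₀ => ?_⟩
  · obtain ⟨x, hx⟩ := Set.iUnion_eq_univ_iff.1 hvc (pr y)
    -- The orbit of `y` lies in some `v x`, hence meets `interior (K x)` at a point where `f x` is
    -- positive.
    obtain ⟨z, hz, hzy⟩ := hvs x hx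
    obtain ⟨a, ha⟩ := Quotient.exact hzy
    refine ⟨a, ?_⟩
    change a • y = z at ha
    rw [ha]
    refine (finsum_pos (fun x => hf0 x z) ⟨x, (hf0 x z).lt_of_ne' ?_⟩ (hlf.point_finite z)).ne'
    rw [← Function.mem_support, hfs]
    exact ⟨hz, by rwa [Set.mem_preimage, hzy]⟩
  -- Only finitely many `v i` meet `W`, and for each of these the elements moving `K x₀` to meet `K
  -- i` form a compact set, by properness. Their union is `L`.
  · obtain ⟨W, hW, hWf⟩ := hvf (pr x₀)
    refine ⟨K x₀ ∩ pr ⁻¹' W, Filter.inter_mem (hKx x₀) (hpr.continuous.continuousAt hW),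
      ⋃ i ∈ {i | (v i ∩ W).Nonempty}, {a : A | (a • K x₀ ∩ K i).Nonempty}, ?_, ?_⟩
    · exact hWf.isCompact_biUnion fun i _ =>
        ProperSMul.isCompact_setOfPred_inter_nonempty (hK x₀) (hK i)
    · rintro y ⟨hy, hyW⟩ a ha
      refine finsum_eq_zero_of_forall_eq_zero fun i => ?_
      by_contra hne
      rw [← ne_eq, ← Function.mem_support, hfs] at hne
      refine ha (Set.mem_biUnion (x := i) ⟨pr y, ?_, hyW⟩
        ⟨a • y, Set.smul_mem_smul_set hy, interior_subset hne.1⟩)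
      rw [← hprsmul a y]
      exact hne.2

end Cutoff

/-! ### Averaging over the group -/

section Averaging

open MeasureTheory

variable {k d : ℕ} {M A : Type*} [TopologicalSpace M] [T2Space M] [SecondCountableTopology M]
  [ChartedSpace (EuclideanSpace ℝ (Fin d)) M]
  [IsManifold (𝓡 d) ∞ M] [Group A] [TopologicalSpace A]
  [MulAction A M]

omit [T2Space M] [SecondCountableTopology M] in
/-- The conformal factors of a smooth action preserving `ker η` depend smoothly on all
variables. -/
theorem contMDiff_conformalFactor [ChartedSpace (EuclideanSpace ℝ (Fin k)) A]
    [LieGroup (𝓡 k) ∞ A] [ContMDiffSMul (𝓡 k) (𝓡 d) ∞ A M] {η : OneForm d M} (hη : SmoothForm η)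
    (hne : ∀ x, ∃ v : TangentSpace (𝓡 d) x, η x v ≠ 0) {c : A → M → ℝ}
    (hc : ∀ (a : A) x (v : TangentSpace (𝓡 d) x),
      η (a • x) (mfderiv (𝓡 d) (𝓡 d) (fun y : M => a • y) x v) = c a x * η x v) :
    ContMDiff ((𝓡 k).prod (𝓡 d)) 𝓘(ℝ, ℝ) ∞ (Function.uncurry c) := by
  rintro ⟨a₀, x₀⟩
  obtain ⟨v₀, hv₀⟩ := hne x₀
  -- With `Z` a local smooth field through `v₀`, the factor `c` is near `(a₀, x₀)` the quotient of
  -- two smooth pairings, with nonvanishing denominator `η(Z)`.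
  let Z : VField d M := FiberBundle.extend (EuclideanSpace ℝ (Fin d)) v₀
  have hZ : ContMDiffAt (𝓡 d) (𝓡 d).tangent ∞
      (fun x => (TotalSpace.mk' (EuclideanSpace ℝ (Fin d)) x (Z x) : TangentBundle (𝓡 d) M)) x₀ :=
    FiberBundle.contMDiffAt_extend (𝓡 d) _ v₀
  have hZ0 : η x₀ (Z x₀) ≠ 0 := by
    simpa only [Z, FiberBundle.extend_apply_self] using hv₀
  have hden : ContMDiffAt (𝓡 d) 𝓘(ℝ, ℝ) ∞ (fun x => η x (Z x)) x₀ :=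
    hη.contMDiffAt_apply (fun x => x) Z hZ
  have hnum : ContMDiffAt ((𝓡 k).prod (𝓡 d)) 𝓘(ℝ, ℝ) ∞ (fun q : A × M =>
      η (q.1 • q.2) (mfderiv (𝓡 d) (𝓡 d) (fun y : M => q.1 • y) q.2 (Z q.2))) (a₀, x₀) := by
    refine hη.contMDiffAt_apply (fun q : A × M => q.1 • q.2) _ ?_
    refine contMDiffAt_mfderiv_vector (fun (q : A × M) (y : M) => q.1 • y) Prod.snd
      (fun q => Z q.2) ?_ ?_
    · exact contMDiffAt_fst.fst.smul contMDiffAt_snd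
    · exact ContMDiffAt.comp (f := (Prod.snd : A × M → M)) (a₀, x₀) hZ contMDiffAt_snd
  have hden' : ContMDiffAt ((𝓡 k).prod (𝓡 d)) 𝓘(ℝ, ℝ) ∞ (fun q : A × M => η q.2 (Z q.2))
      (a₀, x₀) :=
    ContMDiffAt.comp (f := (Prod.snd : A × M → M)) (a₀, x₀) hden contMDiffAt_snd
  refine (hnum.div₀ hden' hZ0).congr_of_eventuallyEq ?_
  filter_upwards [hden'.continuousAt.eventually_ne hZ0] with q hq
  change c q.1 q.2 = _
  rw [Pi.div_apply, hc, mul_div_cancel_right₀ _ hq]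

variable (k) in
/-- If an abelian Lie group acts smoothly and properly, preserving `ker η` and its co-orientation,
then some positive multiple of `η` is invariant. -/
theorem exists_invariant_rescaling [ChartedSpace (EuclideanSpace ℝ (Fin k)) A]
    [LieGroup (𝓡 k) ∞ A] [ContMDiffSMul (𝓡 k) (𝓡 d) ∞ A M] [ProperSMul A M] (hcomm : ∀ a b : A, a * b = b * a)
    {η : OneForm d M} (hη : SmoothForm η)
    (hne : ∀ x, ∃ v : TangentSpace (𝓡 d) x, η x v ≠ 0) {c : A → M → ℝ} (hpos : ∀ a x, 0 < c a x)
    (hc : ∀ (a : A) x (v : TangentSpace (𝓡 d) x),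
      η (a • x) (mfderiv (𝓡 d) (𝓡 d) (fun y : M => a • y) x v) = c a x * η x v) :
    ∃ g : M → ℝ, ContMDiff (𝓡 d) 𝓘(ℝ, ℝ) ∞ g ∧ (∀ x, 0 < g x) ∧
      ∀ (a : A) x (v : TangentSpace (𝓡 d) x),
        g (a • x) * η (a • x) (mfderiv (𝓡 d) (𝓡 d) (fun y : M => a • y) x v) = g x * η x v := by
  have : IsTopologicalGroup A := topologicalGroup_of_lieGroup (𝓡 k) ∞
  -- A topological group with closed points is Hausdorff, as the integration lemmas require.
  have : T1Space A := ChartedSpace.t1Space (EuclideanSpace ℝ (Fin k)) A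
  have : LocallyCompactSpace A := ChartedSpace.locallyCompactSpace (EuclideanSpace ℝ (Fin k)) A
  let : MeasurableSpace A := borel A
  have : BorelSpace A := ⟨rfl⟩
  let μ : Measure A := Measure.haar
  obtain ⟨χ, hχ, hχ0, hχne, hχL⟩ := exists_cutoff_of_properSMul d A M
  have hcs := contMDiff_conformalFactor (k := k) hη hne hc
  have hFs : ContMDiff ((𝓡 k).prod (𝓡 d)) 𝓘(ℝ, ℝ) ∞
      (fun q : A × M => χ (q.1 • q.2) * c q.1 q.2) :=
    (hχ.comp (contMDiff_fst.smul contMDiff_snd)).mul hcs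
  -- The chain rule for `(a * b) • y = a • b • y`, evaluated on a vector where `η` does not vanish.
  have hcocycle : ∀ a b x, c (a * b) x = c a (b • x) * c b x := by
    intro a b x
    obtain ⟨v, hv⟩ := hne x
    refine mul_right_cancel₀ hv ?_
    have hsm : ∀ (a : A) (x : M), MDifferentiableAt (𝓡 d) (𝓡 d) (fun y : M => a • y) x :=
      fun a x => (ContMDiffSMul.contMDiff_const_smul (I := 𝓡 k) (n := ∞) a x).mdifferentiableAt
        (by simp)
    have h1 := mfderiv_comp x (hsm a (b • x)) (hsm b x)
    have h2 := DFunLike.congr_fun h1 v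
    have h3 := hc a (b • x) (mfderiv (𝓡 d) (𝓡 d) (fun y : M => b • y) x v)
    rw [hc b x v, ← mul_assoc] at h3
    rw [← h3, ← hc (a * b) x v]
    have e : (fun y : M => (a * b) • y) = (fun y : M => a • y) ∘ fun y : M => b • y := by
      funext y
      exact mul_smul a b y
    have ηcast : ∀ z z' : M, z = z' → ∀ w w' : EuclideanSpace ℝ (Fin d), w = w' →
        (η z : EuclideanSpace ℝ (Fin d) →L[ℝ] ℝ) w =
          (η z' : EuclideanSpace ℝ (Fin d) →L[ℝ] ℝ) w' := by
      rintro _ _ rfl _ _ rfl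
      rfl
    refine ηcast _ _ (mul_smul a b x) _ _ ?_
    rw [e]
    exact h2
  -- The integrand is the coefficient of `a^*(χη)` relative to `η`.
  let g : M → ℝ := fun x => ∫ a, χ (a • x) * c a x ∂μ
  have hsmooth : ContMDiff (𝓡 d) 𝓘(ℝ, ℝ) ∞ g := by
    intro x₀
    obtain ⟨N, hN, L, hL, hNL⟩ := hχL x₀
    obtain ⟨N', hN'N, hN'o, hxN'⟩ := mem_nhds_iff.1 hN
    let φ := extChartAt (𝓡 d) x₀
    let U := φ.target ∩ φ.symm ⁻¹' N'
    have hU : IsOpen U := (contMDiffOn_extChartAt_symm (I := 𝓡 d) (n := ∞) x₀).continuousOn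
      |>.isOpen_inter_preimage (isOpen_extChartAt_target x₀) hN'o
    have hF : ContMDiffOn ((𝓡 k).prod 𝓘(ℝ, EuclideanSpace ℝ (Fin d))) 𝓘(ℝ, ℝ) ∞
        (Function.uncurry fun (a : A) y => χ (a • φ.symm y) * c a (φ.symm y))
        (Set.univ ×ˢ U) := by
      rintro ⟨a, y⟩ ⟨-, hy⟩
      refine ContMDiffAt.contMDiffWithinAt ?_
      have h1 : ContMDiffAt ((𝓡 k).prod 𝓘(ℝ, EuclideanSpace ℝ (Fin d))) ((𝓡 k).prod (𝓡 d)) ∞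
          (fun q : A × EuclideanSpace ℝ (Fin d) => (q.1, φ.symm q.2)) (a, y) :=
        contMDiffAt_fst.prodMk (ContMDiffAt.comp (f := Prod.snd) (a, y)
          (contMDiffAt_extChartAt_symm_of_mem x₀ hy.1) contMDiffAt_snd)
      exact ContMDiffAt.comp (a, y) (hFs (a, φ.symm y)) h1
    have hint : ContDiffOn ℝ ∞ (fun y => ∫ a in L, χ (a • φ.symm y) * c a (φ.symm y) ∂μ) U :=
      contDiffOn_infty.2 fun m => contDiffOn_setIntegral_param μ hU hL m hF
    have hx₀U : φ x₀ ∈ U := ⟨mem_extChartAt_target x₀, by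
      rw [Set.mem_preimage, extChartAt_to_inv]
      exact hxN'⟩
    have h2 : ContMDiffAt (𝓡 d) 𝓘(ℝ, ℝ) ∞
        ((fun y => ∫ a in L, χ (a • φ.symm y) * c a (φ.symm y) ∂μ) ∘ φ) x₀ :=
      ContMDiffAt.comp x₀ (hint.contDiffAt (hU.mem_nhds hx₀U)).contMDiffAt contMDiffAt_extChartAt
    refine h2.congr_of_eventuallyEq ?_
    filter_upwards [hN, (isOpen_extChartAt_source x₀).mem_nhds
      (mem_extChartAt_source (I := 𝓡 d) x₀)] with x hx hxs
    rw [Function.comp_apply, φ.left_inv hxs]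
    refine (setIntegral_eq_integral_of_forall_compl_eq_zero fun a ha => ?_).symm
    rw [hNL x hx a ha, zero_mul]
  have hgpos : ∀ x, 0 < g x := by
    intro x
    obtain ⟨a, ha⟩ := hχne x
    obtain ⟨N, hN, L, hL, hNL⟩ := hχL x
    refine Continuous.integral_pos_of_hasCompactSupport_nonneg_nonzero (x := a) ?_ ?_ ?_ ?_
    · exact hFs.continuous.comp (f := fun a => (a, x)) (by fun_prop)
    · refine HasCompactSupport.intro hL fun a ha => ?_
      rw [hNL x (mem_of_mem_nhds hN) a ha, zero_mul]
    · exact fun a => mul_nonneg (hχ0 _) (hpos a x).le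
    · exact mul_ne_zero ha (hpos a x).ne'
  -- By the cocycle rule the left-hand side integrates the same function at `a * b`. Commutativity
  -- makes this `b * a`, and left invariance of Haar measure removes `b`.
  have hginv : ∀ b x, g (b • x) * c b x = g x := by
    intro b x
    rw [← integral_mul_const]
    refine Eq.trans ?_ (integral_mul_left_eq_self (μ := μ) (fun a => χ (a • x) * c a x) b)
    refine integral_congr_ae (Filter.Eventually.of_forall fun a => ?_)
    change χ (a • b • x) * c a (b • x) * c b x = χ ((b * a) • x) * c (b * a) x
    rw [hcomm b a, hcocycle, mul_smul, mul_assoc]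
  refine ⟨g, hsmooth, hgpos, fun a x v => ?_⟩
  rw [hc, ← mul_assoc, hginv]

end Averaging

/-! ### Fundamental vector fields of an abelian action -/

section FundamentalFields

variable {k d : ℕ} {M A : Type*} [TopologicalSpace M] [ChartedSpace (EuclideanSpace ℝ (Fin d)) M]
  [Group A] [TopologicalSpace A] [ChartedSpace (EuclideanSpace ℝ (Fin k)) A] [MulAction A M]

variable (k) in
theorem mdifferentiableAt_const_smul [ContMDiffSMul (𝓡 k) (𝓡 d) ∞ A M] (a : A) (x : M) :
    MDifferentiableAt (𝓡 d) (𝓡 d) (fun y : M => a • y) x :=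
  (ContMDiffSMul.contMDiff_const_smul (I := 𝓡 k) (n := ∞) a x).mdifferentiableAt (by simp)

variable [ContMDiffSMul (𝓡 k) (𝓡 d) ∞ A M]

theorem mdifferentiableAt_smul_point (a : A) (x : M) :
    MDifferentiableAt (𝓡 k) (𝓡 d) (fun b : A => b • x) a :=
  (contMDiffAt_id.smul contMDiffAt_const).mdifferentiableAt (n := ∞) (by simp)

/-- Fundamental vector fields of an abelian group action are invariant. -/
theorem fundamentalField_smul (hcomm : ∀ a b : A, a * b = b * a)
    (ξ : TangentSpace (𝓡 k) (1 : A)) (a : A) (x : M) :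
    (fundamentalField ξ (a • x) : EuclideanSpace ℝ (Fin d)) =
      (mfderiv (𝓡 d) (𝓡 d) (fun y : M => a • y) x (fundamentalField ξ x) :
        EuclideanSpace ℝ (Fin d)) := by
  have h := mfderiv_comp_of_eq (f := fun b : A => b • x) (g := fun y : M => a • y) (x := 1) (y := x)
    (I := 𝓡 k) (I' := 𝓡 d) (I'' := 𝓡 d) (mdifferentiableAt_const_smul k a x)
    (mdifferentiableAt_smul_point 1 x) (one_smul A x)
  -- Commutativity lets `a` pass over `b`, so the orbit map at `a • x` is the orbit map at `x`
  -- followed by `a`.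
  have e : (fun b : A => b • a • x) = (fun y : M => a • y) ∘ fun b : A => b • x := by
    funext b
    rw [Function.comp_apply, smul_smul, smul_smul, hcomm]
  refine Eq.trans ?_ ((DFunLike.congr_fun h ξ).trans
    (mfderiv_apply_congr_point _ (one_smul A x) _))
  rw [← e]
  rfl

/-- Invariant functions are constant along fundamental vector fields. -/
theorem fieldDeriv_fundamentalField_of_invariant {h : M → ℝ}
    (hd : MDifferentiable (𝓡 d) 𝓘(ℝ, ℝ) h) (hinv : ∀ (a : A) x, h (a • x) = h x)
    (ξ : TangentSpace (𝓡 k) (1 : A)) (x : M) :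
    fieldDeriv (fundamentalField ξ : VField d M) h x = 0 := by
  have hc := mfderiv_comp_of_eq (f := fun b : A => b • x) (g := h) (x := 1) (y := x)
    (I := 𝓡 k) (I' := 𝓡 d) (I'' := 𝓘(ℝ, ℝ)) (hd x)
    (mdifferentiableAt_smul_point 1 x) (one_smul A x)
  have e : h ∘ (fun b : A => b • x) = fun _ => h x := funext fun b => hinv b x
  rw [e, mfderiv_const] at hc
  have hcast : ∀ z z' : M, z = z' → ∀ w : EuclideanSpace ℝ (Fin d),
      (mfderiv (𝓡 d) 𝓘(ℝ, ℝ) h z w : ℝ) = (mfderiv (𝓡 d) 𝓘(ℝ, ℝ) h z' w : ℝ) := by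
    rintro _ _ rfl _
    rfl
  exact (hcast x _ (one_smul A x).symm _).trans (DFunLike.congr_fun hc ξ).symm

end FundamentalFields

/-! ### Rescaling contact forms and contact fields -/

section ContactForms

variable {n : ℕ} {M : Type*} [TopologicalSpace M]
  [ChartedSpace (EuclideanSpace ℝ (Fin (2 * n + 1))) M] [IsManifold (𝓡 (2 * n + 1)) ∞ M]

/-- A positive multiple of a contact form is a contact form. -/
theorem IsContactForm.smul {η : OneForm (2 * n + 1) M} (hη : IsContactForm η) {g : M → ℝ}
    (hg : ContMDiff (𝓡 (2 * n + 1)) 𝓘(ℝ, ℝ) ∞ g) (hpos : ∀ x, 0 < g x) :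
    IsContactForm fun x => g x • η x where
  smooth := hη.smooth.smul hg
  nondegenerate x := by
    have key : ∀ (α : EuclideanSpace ℝ (Fin (2 * n + 1)) →L[ℝ] ℝ)
        (β β' : EuclideanSpace ℝ (Fin (2 * n + 1)) [⋀^Fin 2]→L[ℝ] ℝ),
        (∀ u w, α u = 0 → α w = 0 → β' ![u, w] = g x * β ![u, w]) →
        (∃ v, wedgePow n α β v ≠ 0) → ∃ v, wedgePow n (g x • α) β' v ≠ 0 := by
      intro α β β' h
      rw [wedgePow_ne_zero_iff, wedgePow_ne_zero_iff,
        wedgeAlternating_smul_of_eqOn_ker α β β' (g x) h]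
      exact smul_ne_zero (mul_ne_zero (hpos x).ne' (pow_ne_zero n (hpos x).ne'))
    exact key (η x) (extDerivForm η x) _
      (fun u w hu hw => extDerivForm_smul_of_ker hη.smooth hg x u w hu hw) (hη.nondegenerate x)

/-- A choice at each point is enough, since `IsReebField` demands no smoothness. -/
theorem IsContactForm.exists_isReebField {η : OneForm (2 * n + 1) M} (hη : IsContactForm η) :
    ∃ R, IsReebField η R := by
  have h : ∀ x, ∃ R : TangentSpace (𝓡 (2 * n + 1)) x, η x R = 1 ∧
      ∀ w, extDerivForm η x ![R, w] = 0 := fun x =>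
    exists_reeb_vector (V := EuclideanSpace ℝ (Fin (2 * n + 1))) finrank_euclideanSpace_fin (η x)
      (extDerivForm η x) (hη.nondegenerate x)
  choose R h1 h2 using h
  exact ⟨R, h1, h2⟩

theorem IsContactForm.exists_apply_ne_zero {η : OneForm (2 * n + 1) M} (hη : IsContactForm η)
    (x : M) : ∃ v : TangentSpace (𝓡 (2 * n + 1)) x, η x v ≠ 0 := by
  obtain ⟨R, hR⟩ := hη.exists_isReebField
  exact ⟨R x, by simp [hR.normalized x]⟩

/-- Being a contact field depends only on the kernel of the form, which a positive factor does not
change. -/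
theorem IsContactField.smul {η : OneForm (2 * n + 1) M} {X : VField (2 * n + 1) M}
    (hX : IsContactField η X) {g : M → ℝ} (hpos : ∀ x, 0 < g x) :
    IsContactField (fun x => g x • η x) X where
  smooth := hX.smooth
  bracket Y hY hYη x := by
    have := hX.bracket Y hY (fun y => (mul_eq_zero.1 (hYη y)).resolve_left (hpos y).ne') x
    exact mul_eq_zero_of_right (g x) this

end ContactForms

end ContactGeometry

end

open ContactGeometry
theorem proposition3p6 {n : ℕ} {M : Type*} [TopologicalSpace M] [T2Space M]
    [SecondCountableTopology M] [ConnectedSpace M]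
    [ChartedSpace (EuclideanSpace ℝ (Fin (2 * n + 1))) M] [IsManifold (𝓡 (2 * n + 1)) ∞ M]
    (η : OneForm (2 * n + 1) M) (f : Fin (n + 1) → M → ℝ) (X : Fin (n + 1) → VField (2 * n + 1) M)
    (hsys : IsCompletelyIntegrable η f X)
    -- `A` is an abelian group of contactomorphisms,
    (A : Subgroup (M ≃ₘ⟮𝓡 (2 * n + 1), 𝓡 (2 * n + 1)⟯ M))
    (hcomm : ∀ a ∈ A, ∀ b ∈ A, a * b = b * a)
    (hcon : (A : Set (M ≃ₘ⟮𝓡 (2 * n + 1), 𝓡 (2 * n + 1)⟯ M)) ⊆ contactomorphismsPos η)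
    -- which is an `(n + 1)`-dimensional Lie group acting smoothly and properly on `M`,
    [TopologicalSpace A] [ChartedSpace (EuclideanSpace ℝ (Fin (n + 1))) A]
    [LieGroup (𝓡 (n + 1)) ∞ A] [ContMDiffSMul (𝓡 (n + 1)) (𝓡 (2 * n + 1)) ∞ A M]
    [ProperSMul A M]
    -- and whose Lie algebra is spanned by the Hamiltonian vector fields.
    (hlie : Set.range (fun ξ : TangentSpace (𝓡 (n + 1)) (1 : A) =>
        (fundamentalField ξ : VField (2 * n + 1) M)) =
      (Submodule.span ℝ (Set.range X) : Set (VField (2 * n + 1) M))) :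
    ∃ η₀ : OneForm (2 * n + 1) M, IsContactForm η₀ ∧ SameContactStructure η η₀ ∧
      (A : Set (M ≃ₘ⟮𝓡 (2 * n + 1), 𝓡 (2 * n + 1)⟯ M)) ⊆ strictContactomorphisms η₀ ∧
      IsCompletelyGood η₀ (fun i x => η₀ x (X i x)) X := by
  have hη := hsys.contactForm
  have hcommA : ∀ a b : A, a * b = b * a := fun a b => Subtype.ext (hcomm a a.2 b b.2)
  have hcf : ∀ a : A, ∃ c : M → ℝ, (∀ x, 0 < c x) ∧ ∀ x (v : TangentSpace (𝓡 (2 * n + 1)) x),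
      η (a • x) (mfderiv (𝓡 (2 * n + 1)) (𝓡 (2 * n + 1)) (fun y : M => a • y) x v) =
        c x * η x v := fun a => hcon a.2
  choose c hcpos hc using hcf
  obtain ⟨g, hg, hgpos, hginv⟩ := exists_invariant_rescaling (n + 1) hcommA hη.smooth
    hη.exists_apply_ne_zero hcpos hc
  have hη₀ := hη.smul hg hgpos
  have hfund : ∀ i, ∃ ξ : TangentSpace (𝓡 (n + 1)) (1 : A), fundamentalField ξ = X i := fun i => by
    have : X i ∈ (Submodule.span ℝ (Set.range X) : Set (VField (2 * n + 1) M)) :=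
      Submodule.subset_span ⟨i, rfl⟩
    rw [← hlie] at this
    exact this
  choose ξ hξ using hfund
  have hval : ∀ i, (fun x => (g x • η x) (X i x)) = fun x => g x * f i x := fun i =>
    funext fun x => congrArg (g x * ·) ((hsys.hamiltonian i).contraction x)
  have hsm : ∀ i, ContMDiff (𝓡 (2 * n + 1)) 𝓘(ℝ, ℝ) ∞ fun x => (g x • η x) (X i x) := fun i => by
    rw [hval i]
    exact hg.mul (hsys.smooth i)
  obtain ⟨R, hR⟩ := hη₀.exists_isReebField
  refine ⟨fun x => g x • η x, hη₀, ⟨g, hg, hgpos, fun _ => rfl⟩,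
    fun a ha x v => hginv ⟨a, ha⟩ x v, ⟨hη₀, hsm, fun i => ⟨(hsys.hamiltonian i).contact.smul hgpos,
      fun _ => rfl⟩, fun i x => ?_, fun i j x => ?_, hsys.independent⟩, fun i => ⟨R, hR, fun x => ?_⟩⟩
  -- First integrals: `η₀` and `X i` are both `A`-invariant, hence so is `η₀(X i)`, and `X 0` is
  -- tangent to the orbits.
  · rw [← hξ 0, ← hξ i]
    refine fieldDeriv_fundamentalField_of_invariant (A := A) ?_ (fun a x => ?_) (ξ 0) x
    · rw [hξ i]
      exact (hsm i).mdifferentiable (by simp)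
    · have h1 := hginv a x (fundamentalField (ξ i) x)
      refine Eq.trans ?_ h1
      exact congrArg (fun w : EuclideanSpace ℝ (Fin (2 * n + 1)) => g (a • x) *
        (η (a • x) : EuclideanSpace ℝ (Fin (2 * n + 1)) →L[ℝ] ℝ) w)
        (fundamentalField_smul hcommA (ξ i) a x)
  · exact mul_eq_zero_of_right (g x) (hsys.involution i j x)
  -- Goodness: Cartan's formula gives `R(η₀(X i)) = -dη₀(X i, R)`, and this vanishes because `R`
  -- lies in the kernel of `dη₀`.
  · have h1 := mfderiv_contraction_of_invariant (A := A) hη₀.smooth (fun a x v => hginv a x v)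
      (ξ i) x (R x)
    rw [hξ i] at h1
    have h2 := form_swap (V := EuclideanSpace ℝ (Fin (2 * n + 1)))
      (extDerivForm (fun x => g x • η x) x) (X i x) (R x)
    exact h1.trans (neg_eq_zero.2 (h2.trans (neg_eq_zero.2 (hR.kernel x (X i x)))))
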